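/- Let $d\ge 2$ and let $L_1\le L_2\le\dots\le L_d$ be positive integers with greatest common divisor $1$. Let $\mathcal O_d$ be the Cuntz algebra, i.e. the universal unital $C^*$-algebra generated by $s_1,\dots,s_d$ with $s_i^*s_j=\delta_{ij}1$ and $\sum_{i=1}^d s_is_i^*=1$. Write $s_\alpha=s_{\alpha_1}\cdots s_{\alpha_k}$ for a finite (possibly empty) word $\alpha=(\alpha_1\dots\alpha_k)$ in $\{1,\dots,d\}$, with $s_\varnothing=1$. Let $\sigma^L$ be the one-parameter group of $*$-automorphisms of $\mathcal O_d$ with $\sigma^L_t(s_j)=e^{itL_j}s_j$, and let $\mathfrak A_L=\{x\in\mathcal O_d:\sigma^L_t(x)=x\ \text{for all } t\in\mathbb R\}$. Then: (1) $\mathfrak A_L$ is a simple AF-algebra. (2) There is exactly one real number $\beta$ with $\sum_{i=1}^d e^{-\beta L_i}=1$, and $\beta>0$. Put $p_i=e^{-\beta L_i}$ and $p^\alpha=p_{\alpha_1}\cdots p_{\alpha_k}$ (with $p^\varnothing=1$). There is exactly one state $\omega$ on $\mathcal O_d$ with $\omega(s_\alpha s_\gamma^*)=\delta_{\alpha\gamma}\,p^\alpha$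 for all words $\alpha,\gamma$. The restriction of $\omega$ to $\mathfrak A_L$ is a trace state, and it is the only trace state of $\mathfrak A_L$. (3) Let $J_L$ be the $L_d\times L_d$ matrix with rows and columns indexed by $0,1,\dots,L_d-1$ and entries $$(J_L)_{w,0}=\#\{k: L_k-1=w\},\qquad (J_L)_{w,v}=\begin{cases}1&\text{if } v=w+1,\\0&\text{otherwise}\end{cases}\quad (v\ge 1).$$ Define vectors $D_n=(D_{n,0},\dots,D_{n,L_d-1})^{\mathrm t}$ by $D_0=(1,0,\dots,0)^{\mathrm t}$ and $D_{n+1}=J_LD_n$ for $n\ge 0$. Then $D_{n,m}=0$ for only finitely many pairs $(n,m)$, and $\mathfrak A_L$ has the following Bratteli diagram. The nodes of row $n=0,1,2,\dots$ are the pairs $(n,m)$, $0\le m\le L_d-1$, with $D_{n,m}\neq 0$; the node $(n,m)$ stands for the full matrix algebra of size $D_{n,m}\times D_{n,m}$; and there are $(J_L)_{w,v}$ edges from the node $(n,v)$ to the node $(n+1,w)$. In particular, from some row on every incidence matrix of the diagram is $J_L$. (4) $J_L$ is primitive, i.e. some power $J_L^k$, $k\geq 1$, has only strictly positive entries. Its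 Perron–Frobenius eigenvalue is $e^\beta$: this is an algebraically simple eigenvalue of $J_L$, there is a vector $v$ with strictly positive components and $vJ_L=e^\beta v$, every other complex eigenvalue $\mu$ of $J_L$ satisfies $|\mu|<e^\beta$, and $e^\beta$ is the only positive real eigenvalue of $J_L$. -/

import Mathlib

open scoped ENNReal ComplexOrder

noncomputable section

/-! ### The Cuntz algebra -/

/-- A realization of the Cuntz relations `sᵢ* sⱼ = δᵢⱼ 1`, `∑ᵢ sᵢ sᵢ* = 1` in a nonzero unital
C⋆-algebra. -/
structure CuntzFamily (d : ℕ) : Type 1 where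
  carrier : Type
  [cstar : CStarAlgebra carrier]
  [nontriv : Nontrivial carrier]
  s : Fin d → carrier
  star_mul : ∀ i j, star (s i) * s j = if i = j then 1 else 0
  sum_mul_star : ∑ i, s i * star (s i) = 1

attribute [instance] CuntzFamily.cstar CuntzFamily.nontriv

/-- The C⋆-algebra of all bounded families `(x_F)_F`, `F` running over all realizations of the
Cuntz relations, with the supremum norm. -/
abbrev CuntzProduct (d : ℕ) : Type 1 := lp (fun F : CuntzFamily d => F.carrier) ∞

instance CuntzProduct.instCStarAlgebra (d : ℕ) : CStarAlgebra (CuntzProduct d) where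
  toNormedRing := lp.inftyNormedRing
  toStarRing := lp.inftyStarRing
  toCompleteSpace := inferInstance
  toCStarRing := lp.inftyCStarRing
  toNormedAlgebra := lp.inftyNormedAlgebra
  toStarModule := inferInstance

lemma CuntzFamily.norm_s_le {d : ℕ} (F : CuntzFamily d) (i : Fin d) : ‖F.s i‖ ≤ 1 := by
  have h := F.star_mul i i
  have h2 := CStarRing.norm_star_mul_self (x := F.s i)
  rw [h, if_pos rfl, CStarRing.norm_one] at h2
  nlinarith [norm_nonneg (F.s i)]

/-- The element of the product whose component at each realization is its `i`-th generator. -/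
def CuntzProduct.gen {d : ℕ} (i : Fin d) : CuntzProduct d :=
  ⟨fun F => F.s i, memℓp_infty ⟨1, by rintro _ ⟨F, rfl⟩; exact F.norm_s_le i⟩⟩

/-- The universal C⋆-algebra on the Cuntz relations, as the C⋆-algebra generated by the universal
generators inside the product of all realizations. -/
def cuntzSubalgebra (d : ℕ) : StarSubalgebra ℂ (CuntzProduct d) :=
  (StarAlgebra.adjoin ℂ (Set.range CuntzProduct.gen)).topologicalClosure

/-- The Cuntz algebra `𝒪_d`. -/
abbrev CuntzAlgebra (d : ℕ) : Type 1 := cuntzSubalgebra d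

instance cuntzSubalgebra.isClosed (d : ℕ) :
    IsClosed (cuntzSubalgebra d : Set (CuntzProduct d)) :=
  StarSubalgebra.isClosed_topologicalClosure _

instance CuntzAlgebra.instCStarAlgebra (d : ℕ) : CStarAlgebra (CuntzAlgebra d) :=
  StarSubalgebra.cstarAlgebra (cuntzSubalgebra d)

namespace CuntzAlgebra

variable {d : ℕ}

/-- The generators `s₁, …, s_d` of `𝒪_d`. -/
def s (i : Fin d) : CuntzAlgebra d :=
  ⟨CuntzProduct.gen i, StarSubalgebra.le_topologicalClosure _
    (StarAlgebra.subset_adjoin ℂ _ ⟨i, rfl⟩)⟩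

lemma star_s_mul_s (i j : Fin d) :
    star (s i) * s j = (if i = j then 1 else 0 : CuntzAlgebra d) := by
  apply Subtype.ext
  apply lp.ext
  funext F
  have h := F.star_mul i j
  split_ifs at h ⊢ with hij <;> exact h

lemma sum_s_mul_star_s : ∑ i, s i * star (s i) = (1 : CuntzAlgebra d) := by
  apply Subtype.ext
  rw [AddSubmonoidClass.coe_finsetSum]
  apply lp.ext
  rw [lp.coeFn_sum]
  funext F
  rw [Finset.sum_apply]
  exact F.sum_mul_star

/-- The universal property: every realization `F` of the Cuntz relations is the image of the
generators under a (unital) ⋆-homomorphism, namely the evaluation of families at `F`. -/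
def lift (F : CuntzFamily d) : CuntzAlgebra d →⋆ₐ[ℂ] F.carrier where
  toFun x := x.1 F
  map_one' := rfl
  map_mul' _ _ := rfl
  map_zero' := rfl
  map_add' _ _ := rfl
  commutes' _ := rfl
  map_star' _ := rfl

lemma lift_s (F : CuntzFamily d) (i : Fin d) : lift F (s i) = F.s i := rfl

/-- The monomial `s_α = s_{α₁} s_{α₂} ⋯ s_{α_k}`, with `s_∅ = 1`. -/
def word (α : List (Fin d)) : CuntzAlgebra d := (α.map s).prod

end CuntzAlgebra

/-! ### The gauge automorphisms and the one-parameter group `σ^L` -/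

/-- The realization `(zᵢ sᵢ)ᵢ` of the Cuntz relations in the same C⋆-algebra. -/
def CuntzFamily.rotate {d : ℕ} (z : Fin d → Circle) (F : CuntzFamily d) : CuntzFamily d where
  carrier := F.carrier
  s i := (z i : ℂ) • F.s i
  star_mul i j := by
    rw [star_smul, smul_mul_smul_comm, F.star_mul]
    split_ifs with h
    · subst h
      rw [RCLike.star_def, ← Circle.coe_inv_eq_conj, ← Circle.coe_mul, inv_mul_cancel,
        Circle.coe_one, one_smul]
    · rw [smul_zero]
  sum_mul_star := by
    rw [← F.sum_mul_star]
    refine Finset.sum_congr rfl fun i _ => ?_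
    rw [star_smul, smul_mul_smul_comm, RCLike.star_def, ← Circle.coe_inv_eq_conj,
      ← Circle.coe_mul, mul_inv_cancel, Circle.coe_one, one_smul]

lemma CuntzFamily.rotate_inv_rotate {d : ℕ} (z : Fin d → Circle) (F : CuntzFamily d) :
    (F.rotate z).rotate z⁻¹ = F := by
  obtain ⟨A, s, h₁, h₂⟩ := F
  have h : (fun i => ((z⁻¹ i : Circle) : ℂ) • (z i : ℂ) • s i) = s := by
    funext i
    rw [smul_smul, ← Circle.coe_mul, Pi.inv_apply, inv_mul_cancel, Circle.coe_one, one_smul]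
  have key : ∀ (s' : Fin d → A) (h₁' : ∀ i j, star (s' i) * s' j = if i = j then 1 else 0)
      (h₂' : ∑ i, s' i * star (s' i) = 1), s' = s →
      CuntzFamily.mk A s' h₁' h₂' = CuntzFamily.mk A s h₁ h₂ := by
    rintro _ _ _ rfl
    rfl
  exact key _ _ _ h

/-- The ⋆-endomorphism `(x_F)_F ↦ (x_{zF})_F` of the product. -/
def CuntzProduct.gauge {d : ℕ} (z : Fin d → Circle) : CuntzProduct d →⋆ₐ[ℂ] CuntzProduct d where
  toFun x := ⟨fun F => x (F.rotate z), memℓp_infty <| by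
    obtain ⟨C, hC⟩ := memℓp_infty_iff.1 x.2
    exact ⟨C, by rintro _ ⟨F, rfl⟩; exact hC ⟨F.rotate z, rfl⟩⟩⟩
  map_one' := rfl
  map_mul' _ _ := rfl
  map_zero' := rfl
  map_add' _ _ := rfl
  commutes' _ := rfl
  map_star' _ := rfl

namespace CuntzAlgebra

variable {d : ℕ}

lemma gauge_mem (z : Fin d → Circle) (x : CuntzAlgebra d) :
    CuntzProduct.gauge z x.1 ∈ cuntzSubalgebra d := by
  have hcont : Continuous (CuntzProduct.gauge z) :=
    open scoped CStarAlgebra in map_continuous (CuntzProduct.gauge z)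
  have hle : cuntzSubalgebra d ≤ (cuntzSubalgebra d).comap (CuntzProduct.gauge z) := by
    refine StarSubalgebra.topologicalClosure_minimal (StarAlgebra.adjoin_le ?_)
      ((cuntzSubalgebra.isClosed d).preimage hcont)
    rintro _ ⟨i, rfl⟩
    exact (cuntzSubalgebra d).smul_mem (s i).2 (z i : ℂ)
  exact hle x.2

/-- The ⋆-automorphism of `𝒪_d` with `sᵢ ↦ zᵢ sᵢ`, for `z` in the torus `𝕋^d`. -/
def gauge (z : Fin d → Circle) : CuntzAlgebra d ≃⋆ₐ[ℂ] CuntzAlgebra d where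
  toFun x := ⟨CuntzProduct.gauge z x.1, gauge_mem z x⟩
  invFun x := ⟨CuntzProduct.gauge z⁻¹ x.1, gauge_mem z⁻¹ x⟩
  left_inv x := by
    apply Subtype.ext
    apply lp.ext
    funext F
    have h : (F.rotate z⁻¹).rotate z = F := by simpa using F.rotate_inv_rotate z⁻¹
    exact eq_of_heq (congr_arg_heq x.1.1 h)
  right_inv x := by
    apply Subtype.ext
    apply lp.ext
    funext F
    exact eq_of_heq (congr_arg_heq x.1.1 (F.rotate_inv_rotate z))
  map_mul' _ _ := rfl
  map_add' _ _ := rfl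
  map_smul' _ _ := rfl
  map_star' _ := rfl

lemma gauge_s (z : Fin d → Circle) (i : Fin d) : gauge z (s i) = (z i : ℂ) • s i := rfl

/-- The one-parameter group `σ^L` of ⋆-automorphisms: `σ_t(s_j) = e^{i t L_j} s_j`. -/
def sigma (L : Fin d → ℕ) (t : ℝ) : CuntzAlgebra d ≃⋆ₐ[ℂ] CuntzAlgebra d :=
  gauge fun j => Circle.exp (t * L j)

lemma sigma_s (L : Fin d → ℕ) (t : ℝ) (j : Fin d) :
    sigma L t (s j) = Complex.exp (Complex.I * t * L j) • s j := by
  have h : ((Circle.exp (t * L j) : Circle) : ℂ) = Complex.exp (Complex.I * t * L j) := by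
    rw [Circle.coe_exp]
    push_cast
    ring_nf
  rw [← h]
  rfl

/-- The fixed-point algebra `𝔄_L` of `σ^L`. -/
def fixedPoints (L : Fin d → ℕ) : StarSubalgebra ℂ (CuntzAlgebra d) where
  carrier := {x | ∀ t : ℝ, sigma L t x = x}
  mul_mem' ha hb t := by rw [map_mul, ha t, hb t]
  add_mem' ha hb t := by rw [map_add, ha t, hb t]
  algebraMap_mem' r t := by
    rw [Algebra.algebraMap_eq_smul_one, map_smul, map_one]
  star_mem' ha t := by rw [map_star, ha t]

instance fixedPoints.isClosed (L : Fin d → ℕ) :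
    IsClosed (fixedPoints L : Set (CuntzAlgebra d)) := by
  have h : (fixedPoints L : Set (CuntzAlgebra d)) = ⋂ t : ℝ, {x | sigma L t x = x} := by
    ext x
    simp only [Set.mem_iInter]
    rfl
  rw [h]
  refine isClosed_iInter fun t => isClosed_eq ?_ continuous_id
  open scoped CStarAlgebra in exact map_continuous (sigma L t)

instance fixedPoints.instCStarAlgebra (L : Fin d → ℕ) : CStarAlgebra (fixedPoints L) :=
  StarSubalgebra.cstarAlgebra (fixedPoints L)

end CuntzAlgebra

/-! ### AF-algebras and trace states -/

/-- An AF-algebra: the closure of the union of an increasing sequence of finite-dimensional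
⋆-subalgebras. -/
def IsAFAlgebra (A : Type*) [CStarAlgebra A] : Prop :=
  ∃ B : ℕ → NonUnitalStarSubalgebra ℂ A, Monotone B ∧ (∀ n, FiniteDimensional ℂ (B n)) ∧
    Dense (⋃ n, (B n : Set A))

/-- A simple C⋆-algebra: it is nonzero, and its only closed two-sided ideals are `0` and the
whole algebra. -/
def IsSimpleCStarAlgebra (A : Type*) [CStarAlgebra A] : Prop :=
  Nontrivial A ∧ ∀ I : TwoSidedIdeal A, IsClosed (I : Set A) → I = ⊥ ∨ I = ⊤

/-- A state: a positive linear functional with value `1` at the unit. -/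
def IsState {A : Type*} [CStarAlgebra A] (φ : A →ₗ[ℂ] ℂ) : Prop :=
  (∀ a, 0 ≤ φ (star a * a)) ∧ φ 1 = 1

/-- A trace state. -/
def IsTraceState {A : Type*} [CStarAlgebra A] (τ : A →ₗ[ℂ] ℂ) : Prop :=
  IsState τ ∧ ∀ a b, τ (a * b) = τ (b * a)

/-! ### Bratteli diagrams -/

/-- A Bratteli diagram (of a unital inductive system): in row `n` finitely many nodes `v`, labelled
by the size `dim n v ≥ 1` of a full matrix algebra, and `mult n w v` edges from the node `v` of
row `n` to the node `w` of row `n + 1`. -/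
structure BratteliDiagram where
  V : ℕ → Type
  [fintype : ∀ n, Fintype (V n)]
  [decEq : ∀ n, DecidableEq (V n)]
  dim : ∀ n, V n → ℕ
  mult : ∀ n, Matrix (V (n + 1)) (V n) ℕ
  dim_pos : ∀ n v, 0 < dim n v
  dim_succ : ∀ n, dim (n + 1) = (mult n).mulVec (dim n)

attribute [instance] BratteliDiagram.fintype BratteliDiagram.decEq

/-- The finite-dimensional C⋆-algebra `⨁_v M_{dim n v}(ℂ)` of row `n`. -/
abbrev BratteliDiagram.RowAlgebra (D : BratteliDiagram) (n : ℕ) : Type :=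
  ∀ v : D.V n, Matrix (Fin (D.dim n v)) (Fin (D.dim n v)) ℂ

/-- `D` is a Bratteli diagram of `A`: there is an increasing sequence of unital ⋆-subalgebras `Bₙ`
with dense union, together with identifications of `Bₙ` with the algebra of row `n`, such that
`mult n w v` is the multiplicity of the partial embedding of the block `v` of `Bₙ` in the block `w`
of `Bₙ₊₁`, i.e. the rank in the block `w` of a minimal (diagonal) projection of the block `v`. -/
def HasBratteliDiagram (A : Type*) [CStarAlgebra A] (D : BratteliDiagram) : Prop :=
  ∃ (B : ℕ → StarSubalgebra ℂ A) (hB : ∀ n, B n ≤ B (n + 1))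
    (φ : ∀ n, B n ≃⋆ₐ[ℂ] D.RowAlgebra n),
    Dense (⋃ n, (B n : Set A)) ∧
    ∀ (n : ℕ) (v : D.V n) (a : Fin (D.dim n v)) (w : D.V (n + 1)),
      (φ (n + 1) (StarSubalgebra.inclusion (hB n)
        ((φ n).symm (Pi.single v (Matrix.single a a 1)))) w).rank = D.mult n w v

/-- The diagram stabilizes after finitely many steps to having the constant incidence matrix `J`:
from some row on, the nodes of each row can be identified with the index set of `J` in such a way
that every incidence matrix is `J`. -/
def BratteliDiagram.StabilizesTo (D : BratteliDiagram) {ι : Type*} (J : Matrix ι ι ℕ) : Prop :=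
  ∃ (n₀ : ℕ) (e : ∀ n, n₀ ≤ n → (D.V n ≃ ι)),
    ∀ (n : ℕ) (h : n₀ ≤ n) (w : D.V (n + 1)) (v : D.V n),
      D.mult n w v = J (e (n + 1) (h.trans n.le_succ) w) (e n h v)

/-- The largest weight, i.e. `L_d` if the weights are increasing. -/
def maxWeight {d : ℕ} (L : Fin d → ℕ) : ℕ := Finset.univ.sup L

/-- The incidence matrix `J_L` on the nodes `0, …, L_d - 1`; the entry at `(w, v)` is the number of
lines from the node `v` to the node `w` of the next row: from `0` to `w` there are as many lines as
there are `k` with `L_k - 1 = w`, and there is a single line from `v` to `v - 1` for `v ≥ 1`. -/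
def incidenceMatrix {d : ℕ} (L : Fin d → ℕ) :
    Matrix (Fin (maxWeight L)) (Fin (maxWeight L)) ℕ :=
  fun w v =>
    if v.val = 0 then (Finset.univ.filter fun k => L k = w.val + 1).card
    else if v.val = w.val + 1 then 1 else 0

/-- The size of the matrix algebra at the node `(n, m)`: row `0` is `1, 0, …, 0`, and each further
row is obtained by applying the incidence matrix. -/
def nodeDim {d : ℕ} (L : Fin d → ℕ) : ℕ → Fin (maxWeight L) → ℕ
  | 0 => fun m => if m.val = 0 then 1 else 0
  | n + 1 => (incidenceMatrix L).mulVec (nodeDim L n)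

/-- The diagram of `𝔄_L`: its nodes are those `(n, m)` which do not correspond to the algebra `0`,
and its edges are those of `J_L` between such nodes. -/
def fixedPointDiagram {d : ℕ} (L : Fin d → ℕ) : BratteliDiagram where
  V n := {m : Fin (maxWeight L) // nodeDim L n m ≠ 0}
  dim n v := nodeDim L n v.1
  mult _ w v := incidenceMatrix L w.1 v.1
  dim_pos n v := Nat.pos_of_ne_zero v.2
  dim_succ n := by
    funext w
    change ∑ v, incidenceMatrix L w.1 v * nodeDim L n v =
      ∑ v : {m : Fin (maxWeight L) // nodeDim L n m ≠ 0},
        incidenceMatrix L w.1 v.1 * nodeDim L n v.1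
    rw [← Finset.sum_filter_of_ne (p := fun v => nodeDim L n v ≠ 0)
      fun v _ h => right_ne_zero_of_mul h]
    exact Finset.sum_subtype _ (fun v => by simp) _

/-! ### Perron–Frobenius eigenvalue -/

/-- `r` is the Perron–Frobenius eigenvalue of `J`: it is positive, it is an algebraically simple
eigenvalue with an eigenvector `v J = r v` with positive components, and `|μ| < r` for all other
complex eigenvalues `μ` of `J`. -/
structure IsPerronFrobeniusEigenvalue {ι : Type*} [Fintype ι] [DecidableEq ι]
    (J : Matrix ι ι ℝ) (r : ℝ) : Prop where
  pos : 0 < r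
  simple : J.charpoly.rootMultiplicity r = 1
  eigenvector : ∃ v : ι → ℝ, (∀ i, 0 < v i) ∧ Matrix.vecMul v J = r • v
  dominant : ∀ μ : ℂ, Module.End.HasEigenvalue (Matrix.toLin' (J.map Complex.ofReal)) μ →
    μ ≠ r → ‖μ‖ < r

end

/-! Everything is governed by the weights of words. The elements s_α s_γ* with α, γ of equal weight
span a dense subspace of 𝔄_L: the mean of σ^L over N-th roots of unity fixes 𝔄_L, and it kills any
given monomial of unequal weights once N is large (`IsCuntz.mem_closure_of_forall_map_eq`).
`IsWordUnits` records the relations among these elements, and the diagram, simplicity and the trace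
are derived from those relations alone.

Let row n consist of the words whose weight reaches n only at their last letter, a word of weight n
+ m sitting at node m; row 0 is the empty word. A row is a complete prefix code, so its balanced
elements are matrix units for the algebra of that row. In passing to row n + 1, a word of weight
above n stays and moves from node m to node m - 1, while a word of weight n is replaced by its d
one-letter extensions. This is exactly the matrix J_L.

Node 0 carries loops of every length L_k; as the gcd is 1, all large powers of J_L are positive. A
nonzero ideal contains a minimal projection of some row by a perturbation argument, and positivity
spreads it over a whole later row, whose diagonal projections sum to 1. A trace state takes on s_α
s_α* a value t(n) depending only on the weight n, with t(n) = ∑ t(n + L_k). Then e^{βn} t(n) is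
nonnegative and harmonic for the random walk with steps L_k of probability p_k. A Harnack inequality
forces it to be constant (`IsNonnegHarmonic.eq_apply_zero`), which is uniqueness.

The state ω is the limit of the iterates of x ↦ ∑ p_i s_i* x s_i, which converge to scalars
(`IsCuntz.tendsto_transfer_pow`). The spectral claims follow from the characteristic polynomial X^M
- ∑ X^(M - L_k), with M the largest weight, by comparing its roots with ∑ e^{-βL_k} = 1. -/

/-! ### Weights of words -/

/-- The weight `L_{α₁} + ⋯ + L_{α_k}` of a word. -/
def wordWeight {d : ℕ} (L : Fin d → ℕ) (α : List (Fin d)) : ℕ := (α.map L).sum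

section Weights

variable {d : ℕ} {L : Fin d → ℕ}

@[simp] lemma wordWeight_nil : wordWeight L [] = 0 := rfl

@[simp] lemma wordWeight_cons (k : Fin d) (α : List (Fin d)) :
    wordWeight L (k :: α) = L k + wordWeight L α := by simp [wordWeight]

@[simp] lemma wordWeight_append (α γ : List (Fin d)) :
    wordWeight L (α ++ γ) = wordWeight L α + wordWeight L γ := by simp [wordWeight]

/-- Concatenation adds weights, so the weights fill the numerical semigroup generated by the L_k;
with gcd 1 it contains all large integers. -/
lemma exists_wordWeight_eq_of_ge (hgcd : Finset.univ.gcd L = 1) :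
    ∃ N, ∀ m ≥ N, ∃ α : List (Fin d), wordWeight L α = m := by
  obtain ⟨N, hN⟩ := Nat.exists_mem_closure_of_ge (Set.range L)
  have h1 : Nat.setGcd (Set.range L) = 1 := by
    rw [← Nat.dvd_one, ← hgcd, Finset.dvd_gcd_iff]
    exact fun i _ => Nat.setGcd_dvd_of_mem ⟨i, rfl⟩
  refine ⟨N, fun m hm => ?_⟩
  have hmem := hN m hm (by simp [h1])
  clear hm
  induction hmem using AddSubmonoid.closure_induction with
  | mem _ h =>
    obtain ⟨k, rfl⟩ := h
    exact ⟨[k], by simp⟩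
  | zero => exact ⟨[], rfl⟩
  | add _ _ _ _ h₁ h₂ =>
    obtain ⟨α, rfl⟩ := h₁
    obtain ⟨γ, rfl⟩ := h₂
    exact ⟨α ++ γ, by simp⟩

lemma le_maxWeight (k : Fin d) : L k ≤ maxWeight L := Finset.le_sup (Finset.mem_univ k)

lemma exists_eq_maxWeight (hd : 0 < d) (L : Fin d → ℕ) : ∃ k, L k = maxWeight L := by
  have : Nonempty (Fin d) := ⟨⟨0, hd⟩⟩
  obtain ⟨k, -, hk⟩ := Finset.exists_mem_eq_sup Finset.univ Finset.univ_nonempty L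
  exact ⟨k, hk.symm⟩

lemma maxWeight_pos (hd : 0 < d) (hpos : ∀ i, 0 < L i) : 0 < maxWeight L :=
  (hpos ⟨0, hd⟩).trans_le (le_maxWeight _)

end Weights

/-! ### The incidence matrix -/

section Incidence

variable {d : ℕ} {L : Fin d → ℕ}

lemma Matrix.pow_add_apply_pos {ι : Type*} [Fintype ι] [DecidableEq ι] {J : Matrix ι ι ℕ} {a b : ℕ}
    {u v w : ι} (h₁ : 0 < (J ^ a) w u) (h₂ : 0 < (J ^ b) u v) : 0 < (J ^ (a + b)) w v := by
  rw [pow_add, Matrix.mul_apply]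
  exact (Nat.mul_pos h₁ h₂).trans_le
    (Finset.single_le_sum (f := fun j => (J ^ a) w j * (J ^ b) j v) (fun _ _ => Nat.zero_le _)
      (Finset.mem_univ u))

/-- Follow the single edges v → v - 1 → ⋯ → w. -/
lemma incidenceMatrix_pow_apply_pos_down (v w : Fin (maxWeight L)) (h : w ≤ v) :
    0 < (incidenceMatrix L ^ (v.val - w.val)) w v := by
  obtain ⟨v, hv⟩ := v
  obtain ⟨w, hw⟩ := w
  obtain ⟨i, rfl⟩ := Nat.exists_eq_add_of_le (show w ≤ v from h)
  simp only [Nat.add_sub_cancel_left]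
  clear h
  induction i with
  | zero => simp
  | succ i ih =>
    refine Matrix.pow_add_apply_pos (u := ⟨w + i, by omega⟩) (ih _) ?_
    simp [incidenceMatrix, ← add_assoc]

lemma incidenceMatrix_apply_zero_pos (h0 : 0 < maxWeight L) (k : Fin d) (hk : 0 < L k) :
    0 < (incidenceMatrix L ^ 1) ⟨L k - 1, by have := le_maxWeight (L := L) k; omega⟩ ⟨0, h0⟩ := by
  rw [pow_one]
  simp only [incidenceMatrix, if_true]
  exact Finset.card_pos.2 ⟨k, by simp; omega⟩

/-- Each letter k gives a loop of length L_k at node 0: one edge to node L_k - 1, then L_k - 1 steps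
down. A word concatenates such loops. -/
lemma incidenceMatrix_pow_wordWeight_pos (h0 : 0 < maxWeight L) (hpos : ∀ i, 0 < L i)
    (α : List (Fin d)) :
    0 < (incidenceMatrix L ^ wordWeight L α) ⟨0, h0⟩ ⟨0, h0⟩ := by
  induction α with
  | nil => simp
  | cons k α ih =>
    rw [wordWeight_cons]
    refine Matrix.pow_add_apply_pos (u := ⟨0, h0⟩) ?_ ih
    have h := Matrix.pow_add_apply_pos
      (incidenceMatrix_pow_apply_pos_down ⟨L k - 1, by have := le_maxWeight (L := L) k; omega⟩
        ⟨0, h0⟩ (by simp [Fin.le_def])) (incidenceMatrix_apply_zero_pos h0 k (hpos k))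
    have e : L k - 1 - 0 + 1 = L k := by have := hpos k; omega
    simpa only [e] using h

/-- All sufficiently large powers of the incidence matrix are strictly positive. -/
lemma exists_incidenceMatrix_pow_pos (hd : 0 < d) (hpos : ∀ i, 0 < L i)
    (hgcd : Finset.univ.gcd L = 1) :
    ∃ K, ∀ k ≥ K, ∀ w v, 0 < (incidenceMatrix L ^ k) w v := by
  have h0 := maxWeight_pos hd hpos
  obtain ⟨N, hN⟩ := exists_wordWeight_eq_of_ge hgcd
  obtain ⟨q, hq⟩ := exists_eq_maxWeight hd L
  -- The path from v to w of length k: descend to 0, run a loop of the missing weight, jump to the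
  -- top node M - 1, descend to w. The first and the last two pieces take v + M - w steps, so k ≥ N
  -- + 2M leaves at least N for the loop.
  refine ⟨N + 2 * maxWeight L, fun k hk w v => ?_⟩
  obtain ⟨α, hα⟩ := hN (k - v - maxWeight L + w) (by have := v.2; omega)
  have h₁ := incidenceMatrix_pow_apply_pos_down v ⟨0, h0⟩ (by simp [Fin.le_def])
  have h₂ := incidenceMatrix_pow_wordWeight_pos h0 hpos α
  have h₃ := incidenceMatrix_apply_zero_pos h0 q (hpos q)
  have h₄ := incidenceMatrix_pow_apply_pos_down (L := L) ⟨L q - 1, by omega⟩ w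
    (by rw [Fin.le_def]; have := w.2; simp only; omega)
  have h := Matrix.pow_add_apply_pos h₄ (Matrix.pow_add_apply_pos h₃ (Matrix.pow_add_apply_pos h₂ h₁))
  have e : L q - 1 - w + (1 + (wordWeight L α + (v - 0))) = k := by
    have := w.2; have := v.2; omega
  simpa only [e] using h

lemma nodeDim_eq_pow_apply (h0 : 0 < maxWeight L) (n : ℕ) (m : Fin (maxWeight L)) :
    nodeDim L n m = (incidenceMatrix L ^ n) m ⟨0, h0⟩ := by
  induction n generalizing m with
  | zero =>
    simp [nodeDim, Matrix.one_apply, Fin.ext_iff]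
  | succ n ih =>
    rw [pow_succ', Matrix.mul_apply]
    simp only [nodeDim, Matrix.mulVec, dotProduct, ih]

lemma finite_setOf_nodeDim_eq_zero (hd : 0 < d) (hpos : ∀ i, 0 < L i)
    (hgcd : Finset.univ.gcd L = 1) :
    {nm : ℕ × Fin (maxWeight L) | nodeDim L nm.1 nm.2 = 0}.Finite := by
  obtain ⟨K, hK⟩ := exists_incidenceMatrix_pow_pos hd hpos hgcd
  refine ((Set.finite_lt_nat K).prod Set.finite_univ).subset fun nm hnm => ⟨?_, trivial⟩
  by_contra h
  have := hK nm.1 (not_lt.1 h) nm.2 ⟨0, maxWeight_pos hd hpos⟩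
  rw [← nodeDim_eq_pow_apply] at this
  exact this.ne' hnm

lemma fixedPointDiagram_stabilizesTo (hd : 0 < d) (hpos : ∀ i, 0 < L i)
    (hgcd : Finset.univ.gcd L = 1) :
    (fixedPointDiagram L).StabilizesTo (incidenceMatrix L) := by
  obtain ⟨K, hK⟩ := exists_incidenceMatrix_pow_pos hd hpos hgcd
  have h (n : ℕ) (hn : K ≤ n) (m : Fin (maxWeight L)) : nodeDim L n m ≠ 0 := by
    rw [nodeDim_eq_pow_apply (maxWeight_pos hd hpos)]
    exact (hK n hn _ _).ne'
  exact ⟨K, fun n hn => Equiv.subtypeUnivEquiv (h n hn), fun n hn w v => rfl⟩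

lemma incidenceMatrix_isPrimitive (hd : 0 < d) (hpos : ∀ i, 0 < L i)
    (hgcd : Finset.univ.gcd L = 1) :
    ((incidenceMatrix L).map (Nat.cast : ℕ → ℝ)).IsPrimitive := by
  obtain ⟨K, hK⟩ := exists_incidenceMatrix_pow_pos hd hpos hgcd
  refine ⟨fun _ _ => Nat.cast_nonneg _, K + 1, K.succ_pos, fun i j => ?_⟩
  have h : (incidenceMatrix L).map (Nat.cast : ℕ → ℝ) ^ (K + 1) =
      (incidenceMatrix L ^ (K + 1)).map (Nat.cast : ℕ → ℝ) :=
    (map_pow (Nat.castRingHom ℝ).mapMatrix (incidenceMatrix L) (K + 1)).symm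
  rw [h]
  exact Nat.cast_pos.2 (hK (K + 1) K.le_succ i j)

/-! ### Characteristic polynomial and Perron–Frobenius eigenvalue of J_L -/

open Polynomial in
/-- The characteristic polynomial of the incidence matrix. -/
noncomputable def weightPolynomial (K : Type*) [Field K] (L : Fin d → ℕ) : K[X] :=
  X ^ maxWeight L - ∑ k, X ^ (maxWeight L - L k)

open Polynomial in
lemma degree_sum_X_pow_lt (K : Type*) [Field K] (hd : 0 < d) (hpos : ∀ i, 0 < L i) :
    (∑ k, X ^ (maxWeight L - L k) : K[X]).degree < maxWeight L := by
  refine (degree_sum_le _ _).trans_lt ((Finset.sup_lt_iff (WithBot.bot_lt_coe _)).2 fun k _ => ?_)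
  rw [degree_X_pow]
  have := hpos k
  have := maxWeight_pos hd hpos
  exact_mod_cast (by omega : maxWeight L - L k < maxWeight L)

open Polynomial in
lemma weightPolynomial_monic (K : Type*) [Field K] (hd : 0 < d) (hpos : ∀ i, 0 < L i) :
    (weightPolynomial K L).Monic :=
  monic_X_pow_sub (degree_sum_X_pow_lt K hd hpos)

open Polynomial in
lemma natDegree_weightPolynomial (K : Type*) [Field K] (hd : 0 < d) (hpos : ∀ i, 0 < L i) :
    (weightPolynomial K L).natDegree = maxWeight L := by
  refine natDegree_eq_of_degree_eq_some ?_
  rw [weightPolynomial, degree_sub_eq_left_of_degree_lt, degree_X_pow]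
  rw [degree_X_pow]
  exact degree_sum_X_pow_lt K hd hpos

-- With its nodes in reverse order J_L is a companion matrix: multiplication by the root X in
-- K[X]/(f), f = `weightPolynomial`, in the power basis. Its characteristic polynomial is therefore
-- the minimal polynomial f of that root.
open Polynomial in
lemma charpoly_incidenceMatrix (K : Type*) [Field K] (hd : 0 < d) (hpos : ∀ i, 0 < L i) :
    ((incidenceMatrix L).map (Nat.cast : ℕ → K)).charpoly = weightPolynomial K L := by
  have hm := weightPolynomial_monic K hd hpos
  have hdeg := natDegree_weightPolynomial K hd hpos
  set pb := AdjoinRoot.powerBasis hm.ne_zero with hpb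
  have hdim : pb.dim = maxWeight L := hdeg
  have hmin : minpoly K pb.gen = weightPolynomial K L :=
    AdjoinRoot.minpoly_powerBasis_gen_of_monic hm
  rw [← hmin, ← charpoly_leftMulMatrix, PowerBasis.leftMulMatrix, PowerBasis.minpolyGen_eq, hmin,
    ← Matrix.charpoly_reindex ((finCongr hdim).trans Fin.revPerm)]
  congr 1
  ext w v
  have hw := w.2
  have hv := v.2
  simp only [Matrix.map_apply, Matrix.reindex_apply, Matrix.submatrix_apply, Matrix.of_apply,
    Equiv.symm_trans_apply, Fin.revPerm_symm, Fin.revPerm_apply, finCongr_symm, finCongr_apply,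
    Fin.val_cast, Fin.val_rev, hdim, incidenceMatrix]
  by_cases h0 : v.val = 0
  · rw [if_pos h0, if_pos (by omega), weightPolynomial, coeff_sub, coeff_X_pow,
      if_neg (by omega), finsetSum_coeff]
    simp only [coeff_X_pow, zero_sub, neg_neg]
    rw [Finset.sum_boole]
    congr 2
    ext k
    have := hpos k
    have := le_maxWeight (L := L) k
    simp only [Finset.mem_filter, Finset.mem_univ, true_and]
    omega
  · rw [if_neg h0, if_neg (show ¬ maxWeight L - (v.val + 1) + 1 = maxWeight L by omega)]
    have : (v.val = w.val + 1) ↔ (maxWeight L - (w.val + 1) = maxWeight L - (v.val + 1) + 1) := by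
      omega
    simp only [this, Nat.cast_ite, Nat.cast_one, Nat.cast_zero]

/-- Divide the characteristic equation by r^M. With r = e^β the result is the defining equation of
β. -/
lemma sum_inv_pow_eq_one_of_hasEigenvalue {K : Type*} [Field K] (hd : 0 < d)
    (hpos : ∀ i, 0 < L i) {r : K} (hr : r ≠ 0)
    (h : Module.End.HasEigenvalue
      (Matrix.toLin' ((incidenceMatrix L).map (Nat.cast : ℕ → K))) r) :
    ∑ k, r⁻¹ ^ L k = 1 := by
  rw [Module.End.hasEigenvalue_iff_isRoot_charpoly, Matrix.charpoly_toLin',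
    charpoly_incidenceMatrix K hd hpos, weightPolynomial, Polynomial.IsRoot.def] at h
  simp only [Polynomial.eval_sub, Polynomial.eval_pow, Polynomial.eval_X,
    Polynomial.eval_finsetSum, sub_eq_zero] at h
  have hM : r ^ maxWeight L ≠ 0 := pow_ne_zero _ hr
  rw [← mul_right_inj' hM, mul_one, Finset.mul_sum]
  conv_rhs => rw [h]
  refine Finset.sum_congr rfl fun k _ => ?_
  rw [pow_sub₀ r hr (le_maxWeight k), inv_pow]

lemma sum_inv_pow_eq {β : ℝ} (hβ : ∑ i, Real.exp (-β * L i) = 1) :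
    ∑ k, (Real.exp β)⁻¹ ^ L k = 1 := by
  rw [← hβ]
  refine Finset.sum_congr rfl fun k _ => ?_
  rw [← Real.exp_neg, ← Real.exp_nat_mul, mul_comm]

lemma eq_exp_of_hasEigenvalue (hd : 0 < d) (hpos : ∀ i, 0 < L i) {β : ℝ}
    (huniq : ∀ β' : ℝ, ∑ i, Real.exp (-β' * L i) = 1 → β' = β) (r : ℝ) (hr : 0 < r)
    (h : Module.End.HasEigenvalue
      (Matrix.toLin' ((incidenceMatrix L).map (Nat.cast : ℕ → ℝ))) r) : r = Real.exp β := by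
  rw [← huniq (Real.log r), Real.exp_log hr]
  rw [← sum_inv_pow_eq_one_of_hasEigenvalue hd hpos hr.ne' h]
  refine Finset.sum_congr rfl fun k _ => ?_
  rw [mul_comm, Real.exp_nat_mul, Real.exp_neg, Real.exp_log hr]

/-- For the characteristic polynomial f, r f'(r) = r^M ∑ L_k r^(-L_k) > 0, using f(r) = 0 to rewrite
the leading term; so the root r is simple. -/
lemma rootMultiplicity_charpoly_incidenceMatrix (hd : 0 < d) (hpos : ∀ i, 0 < L i) {β : ℝ}
    (hβ : ∑ i, Real.exp (-β * L i) = 1) :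
    ((incidenceMatrix L).map (Nat.cast : ℕ → ℝ)).charpoly.rootMultiplicity (Real.exp β) = 1 := by
  set r := Real.exp β with hr
  have hr0 : 0 < r := Real.exp_pos β
  have hsum := sum_inv_pow_eq hβ
  rw [charpoly_incidenceMatrix ℝ hd hpos]
  have hne := (weightPolynomial_monic ℝ hd hpos).ne_zero
  have hpow (k : Fin d) : r ^ (maxWeight L - L k) = r ^ maxWeight L * r⁻¹ ^ L k := by
    rw [pow_sub₀ r hr0.ne' (le_maxWeight k), inv_pow]
  have hroot : (weightPolynomial ℝ L).IsRoot r := by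
    simp only [weightPolynomial, Polynomial.IsRoot.def, Polynomial.eval_sub, Polynomial.eval_pow,
      Polynomial.eval_X, Polynomial.eval_finsetSum, hpow]
    rw [← Finset.mul_sum, hsum, mul_one, sub_self]
  refine le_antisymm (not_lt.1 fun h => ?_) ((Polynomial.rootMultiplicity_pos hne).2 hroot)
  have hd' := ((Polynomial.one_lt_rootMultiplicity_iff_isRoot hne).1 h).2
  -- Pulling out r⁻¹ removes the truncated exponent n - 1, and the identity survives at n = 0, where
  -- both sides vanish.
  have hpow' (n : ℕ) : (n : ℝ) * r ^ (n - 1) = r⁻¹ * (n * r ^ n) := by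
    cases n with
    | zero => simp
    | succ n => rw [Nat.add_sub_cancel, pow_succ]; field_simp
  simp only [weightPolynomial, Polynomial.IsRoot.def, Polynomial.derivative_sub,
    Polynomial.derivative_X_pow, Polynomial.derivative_sum, Polynomial.eval_sub,
    Polynomial.eval_finsetSum, Polynomial.eval_mul, Polynomial.eval_pow, Polynomial.eval_X,
    Polynomial.eval_natCast, map_natCast, hpow'] at hd'
  rw [← Finset.mul_sum, ← mul_sub, mul_eq_zero, or_iff_right (inv_ne_zero hr0.ne')] at hd'
  have key : (maxWeight L : ℝ) * r ^ maxWeight L -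
      ∑ k, ((maxWeight L - L k : ℕ) : ℝ) * r ^ (maxWeight L - L k) =
      ∑ k, (L k : ℝ) * (r ^ maxWeight L * r⁻¹ ^ L k) := by
    have : (maxWeight L : ℝ) * r ^ maxWeight L =
        ∑ k, (maxWeight L : ℝ) * (r ^ maxWeight L * r⁻¹ ^ L k) := by
      rw [← Finset.mul_sum, ← Finset.mul_sum, hsum, mul_one]
    rw [this, ← Finset.sum_sub_distrib]
    refine Finset.sum_congr rfl fun k _ => ?_
    rw [hpow, Nat.cast_sub (le_maxWeight k)]
    ring
  rw [key] at hd'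
  have : Nonempty (Fin d) := ⟨⟨0, hd⟩⟩
  refine (Finset.sum_pos (fun k _ => ?_) Finset.univ_nonempty).ne' hd'
  have := Nat.cast_pos (α := ℝ).2 (hpos k)
  positivity

lemma Complex.eq_ofReal_of_le_re {z : ℂ} {a : ℝ} (h₁ : ‖z‖ ≤ a) (h₂ : a ≤ z.re) : z = a := by
  have h : z.re = a := le_antisymm ((Complex.re_le_norm z).trans h₁) h₂
  have h₃ : ‖z‖ = |z.re| := by
    rw [h]
    exact le_antisymm (h₁.trans (le_abs_self a)) (h ▸ Complex.abs_re_le_norm z)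
  refine Complex.ext (by simpa using h) ?_
  have := Complex.sq_norm z
  rw [h₃, sq_abs, Complex.normSq_apply] at this
  have : z.im * z.im = 0 := by nlinarith
  simpa using this

/-- If |z| ≥ r, then Re z^(-L_k) ≤ r^(-L_k) for each k, while both families sum to 1. Equality holds
termwise, so (r/z)^(L_k) = 1 for every k, and gcd 1 gives z = r. -/
lemma norm_lt_exp_of_hasEigenvalue (hd : 0 < d) (hpos : ∀ i, 0 < L i)
    (hgcd : Finset.univ.gcd L = 1) {β : ℝ} (hβ : ∑ i, Real.exp (-β * L i) = 1) (z : ℂ)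
    (h : Module.End.HasEigenvalue
      (Matrix.toLin' ((incidenceMatrix L).map (Nat.cast : ℕ → ℂ))) z)
    (hz : z ≠ Real.exp β) : ‖z‖ < Real.exp β := by
  by_contra! hle
  set r := Real.exp β with hr
  have hr0 : 0 < r := Real.exp_pos β
  have hz0 : z ≠ 0 := norm_pos_iff.1 (hr0.trans_le hle)
  have h1 := sum_inv_pow_eq_one_of_hasEigenvalue hd hpos hz0 h
  have hsum := sum_inv_pow_eq hβ
  have hn (k : Fin d) : ‖z⁻¹ ^ L k‖ ≤ r⁻¹ ^ L k := by
    rw [norm_pow, norm_inv]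
    exact pow_le_pow_left₀ (by positivity) (inv_anti₀ hr0 hle) _
  have hre (k : Fin d) : (z⁻¹ ^ L k).re ≤ r⁻¹ ^ L k := (Complex.re_le_norm _).trans (hn k)
  have heq : ∑ k, (z⁻¹ ^ L k).re = ∑ k, r⁻¹ ^ L k := by
    rw [hsum, ← Complex.re_sum, h1, Complex.one_re]
  have hk (k : Fin d) : z⁻¹ ^ L k = ((r⁻¹ ^ L k : ℝ) : ℂ) :=
    Complex.eq_ofReal_of_le_re (hn k)
      ((Finset.sum_eq_sum_iff_of_le fun k _ => hre k).1 heq k (Finset.mem_univ k)).ge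
  have hone (k : Fin d) : ((r : ℂ) * z⁻¹) ^ L k = 1 := by
    rw [mul_pow, hk, ← Complex.ofReal_pow, ← Complex.ofReal_mul, ← mul_pow,
      mul_inv_cancel₀ hr0.ne', one_pow, Complex.ofReal_one]
  have hord : orderOf ((r : ℂ) * z⁻¹) ∣ 1 := by
    rw [← hgcd, Finset.dvd_gcd_iff]
    exact fun k _ => orderOf_dvd_of_pow_eq_one (hone k)
  rw [Nat.dvd_one, orderOf_eq_one_iff, mul_inv_eq_one₀ hz0] at hord
  exact hz hord.symm

lemma isPerronFrobeniusEigenvalue_incidenceMatrix (hd : 0 < d) (hpos : ∀ i, 0 < L i)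
    (hgcd : Finset.univ.gcd L = 1) {β : ℝ} (hβ : ∑ i, Real.exp (-β * L i) = 1) :
    IsPerronFrobeniusEigenvalue ((incidenceMatrix L).map (Nat.cast : ℕ → ℝ)) (Real.exp β) where
  pos := Real.exp_pos β
  simple := rootMultiplicity_charpoly_incidenceMatrix hd hpos hβ
  eigenvector := by
    set r := Real.exp β with hr
    have hr0 : 0 < r := Real.exp_pos β
    -- Columns u ≥ 1 of vJ = rv say v_(u-1) = r v_u, which forces the geometric vector; column 0 is
    -- then ∑ r^(-L_k) = 1.
    refine ⟨fun i => r⁻¹ ^ i.val, fun i => by positivity, ?_⟩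
    funext u
    simp only [Matrix.vecMul, dotProduct, Matrix.map_apply, Pi.smul_apply, smul_eq_mul]
    by_cases hu : u.val = 0
    · simp only [incidenceMatrix, hu, if_true, pow_zero, mul_one]
      have : ∀ w : Fin (maxWeight L), r⁻¹ ^ w.val *
          ((Finset.univ.filter fun k => L k = w.val + 1).card : ℝ) =
          ∑ k ∈ Finset.univ.filter fun k => L k = w.val + 1, r * r⁻¹ ^ L k := by
        intro w
        rw [Finset.sum_congr rfl (g := fun _ => r⁻¹ ^ w.val), Finset.sum_const, nsmul_eq_mul,
          mul_comm]
        intro k hk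
        rw [(Finset.mem_filter.1 hk).2, pow_succ']
        field_simp
      simp only [this]
      rw [Finset.sum_congr rfl fun w _ => Finset.sum_filter _ _, Finset.sum_comm]
      conv_rhs => rw [← mul_one r, ← sum_inv_pow_eq hβ, Finset.mul_sum]
      refine Finset.sum_congr rfl fun k _ => ?_
      have h1 := hpos k
      have h2 := le_maxWeight (L := L) k
      rw [Finset.sum_eq_single ⟨L k - 1, by omega⟩]
      · rw [if_pos (by simp only; omega)]
      · intro w _ hw
        rw [if_neg]
        intro h
        apply hw
        ext
        simp only
        omega
      · simp
    · have hu' := u.2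
      rw [Finset.sum_eq_single ⟨u.val - 1, by omega⟩]
      · rw [incidenceMatrix, if_neg hu, if_pos (by simp only; omega)]
        obtain ⟨i, hi⟩ := Nat.exists_eq_succ_of_ne_zero hu
        simp only [hi, Nat.succ_eq_add_one, Nat.add_sub_cancel, pow_succ', Nat.cast_one, mul_one]
        field_simp
      · intro w _ hw
        rw [incidenceMatrix, if_neg hu, if_neg, Nat.cast_zero, mul_zero]
        intro h
        apply hw
        ext
        simp only
        omega
      · simp
  dominant μ h hμ := by
    refine norm_lt_exp_of_hasEigenvalue hd hpos hgcd hβ μ ?_ hμ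
    convert! h using 2

end Incidence

/-! ### The inverse temperature -/

lemma exists_unique_sum_exp_eq_one {d : ℕ} (hd : 2 ≤ d) {L : Fin d → ℕ} (hpos : ∀ i, 0 < L i) :
    ∃ β : ℝ, 0 < β ∧ ∑ i, Real.exp (-β * L i) = 1 ∧
      ∀ β' : ℝ, ∑ i, Real.exp (-β' * L i) = 1 → β' = β := by
  have : Nonempty (Fin d) := ⟨⟨0, by omega⟩⟩
  set f : ℝ → ℝ := fun β => ∑ i, Real.exp (-β * L i) with hf
  have hanti : StrictAnti f := by
    intro a b hab
    refine Finset.sum_lt_sum_of_nonempty Finset.univ_nonempty fun i _ => ?_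
    have := Nat.cast_pos (α := ℝ).2 (hpos i)
    exact Real.exp_lt_exp.2 (by nlinarith)
  have h0 : f 0 = d := by simp [hf]
  -- As L_i ≥ 1, each of the d terms at log d is at most 1/d; hence the zero of f - 1 lies in [0,
  -- log d].
  have h1 : f (Real.log d) ≤ 1 := by
    have hd0 : (0 : ℝ) < d := by exact_mod_cast (by omega : 0 < d)
    have hlog : 0 ≤ Real.log d := Real.log_natCast_nonneg d
    calc f (Real.log d) ≤ ∑ _i : Fin d, (d : ℝ)⁻¹ := by
          refine Finset.sum_le_sum fun i _ => ?_
          rw [← Real.exp_log hd0, ← Real.exp_neg, Real.exp_log hd0]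
          have : (1 : ℝ) ≤ L i := by exact_mod_cast hpos i
          exact Real.exp_le_exp.2 (by nlinarith)
      _ = 1 := by simp [hd0.ne']
  have hcont : Continuous f := by fun_prop
  have hd2 : (2 : ℝ) ≤ d := by exact_mod_cast hd
  obtain ⟨β, hβ, hβ1⟩ := intermediate_value_Icc' (Real.log_natCast_nonneg d) hcont.continuousOn
    (show (1 : ℝ) ∈ Set.Icc (f (Real.log d)) (f 0) from ⟨h1, by rw [h0]; linarith⟩)
  refine ⟨β, lt_of_le_of_ne hβ.1 ?_, hβ1, fun β' h => hanti.injective (h.trans hβ1.symm)⟩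
  rintro rfl
  rw [h0] at hβ1
  linarith

/-! ### Nonnegative harmonic functions on the semigroup of weights -/

section Harmonic

variable {d : ℕ} {L : Fin d → ℕ} {p : Fin d → ℝ}

/-- `f` is nonnegative and harmonic on the set of all weights of words, for the random walk with
steps `L k` of probability `p k`. -/
structure IsNonnegHarmonic (L : Fin d → ℕ) (p : Fin d → ℝ) (f : ℕ → ℝ) : Prop where
  nonneg : ∀ α, 0 ≤ f (wordWeight L α)
  harmonic : ∀ α, f (wordWeight L α) = ∑ k, p k * f (wordWeight L α + L k)

/-- Iterate harmonicity along γ and keep only the term that follows γ; the discarded ones are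
nonnegative. -/
lemma IsNonnegHarmonic.prod_mul_le {f : ℕ → ℝ} (hf : IsNonnegHarmonic L p f)
    (hp : ∀ k, 0 < p k) (γ α : List (Fin d)) :
    (γ.map p).prod * f (wordWeight L α + wordWeight L γ) ≤ f (wordWeight L α) := by
  induction γ generalizing α with
  | nil => simp
  | cons k γ ih =>
    have h := ih (α ++ [k])
    have hk : p k * f (wordWeight L α + L k) ≤ f (wordWeight L α) := by
      rw [hf.harmonic α]
      refine Finset.single_le_sum (f := fun k => p k * f (wordWeight L α + L k))
        (fun j _ => mul_nonneg (hp j).le ?_) (Finset.mem_univ k)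
      simpa using hf.nonneg (α ++ [j])
    simp only [wordWeight_append, wordWeight_cons, wordWeight_nil, add_zero, List.map_cons,
      List.prod_cons, ← add_assoc] at h ⊢
    calc p k * (γ.map p).prod * f (wordWeight L α + L k + wordWeight L γ)
        = p k * ((γ.map p).prod * f (wordWeight L α + L k + wordWeight L γ)) := by ring
      _ ≤ p k * f (wordWeight L α + L k) := mul_le_mul_of_nonneg_left h (hp k).le
      _ ≤ f (wordWeight L α) := hk

/-- A Harnack inequality: the constants are the same for all nonnegative harmonic functions. -/
lemma exists_harnack (hp : ∀ k, 0 < p k) (hsum : ∑ k, p k = 1) (hpos : ∀ i, 0 < L i)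
    (hgcd : Finset.univ.gcd L = 1) :
    ∃ (K : ℕ) (c : ℝ), 0 < c ∧ ∀ f, IsNonnegHarmonic L p f →
      ∀ α n, wordWeight L α + K ≤ n → c * f n ≤ f (wordWeight L α) := by
  obtain ⟨N, hN⟩ := exists_wordWeight_eq_of_ge hgcd
  choose w hw using hN
  -- One chosen word for each gap in [N, N + M], and the probability of following it. The Harnack
  -- constant is the least of these finitely many probabilities.
  set q : Finset.range (maxWeight L + 1) → ℝ := fun j => ((w (N + j) (by omega)).map p).prod with hq
  have hne : (Finset.univ : Finset (Finset.range (maxWeight L + 1))).Nonempty :=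
    ⟨⟨0, by simp⟩, Finset.mem_univ _⟩
  refine ⟨N, Finset.univ.inf' hne q, ?_, fun f hf α n hn => ?_⟩
  · rw [Finset.lt_inf'_iff]
    intro j _
    refine List.prod_pos fun x hx => ?_
    obtain ⟨k, -, rfl⟩ := List.mem_map.1 hx
    exact hp k
  · obtain ⟨i, hi⟩ : ∃ i, n - wordWeight L α = i := ⟨_, rfl⟩
    induction i using Nat.strong_induction_on generalizing α with
    | _ i ih =>
      by_cases h : i ≤ N + maxWeight L
      · set j : Finset.range (maxWeight L + 1) := ⟨i - N, by rw [Finset.mem_range]; omega⟩ with hj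
        have hnj : n = wordWeight L α + wordWeight L (w (N + j) (by omega)) := by
          rw [hw]
          simp only [hj]
          omega
        have h0 : 0 ≤ f n := by
          have := hf.nonneg (α ++ w (N + j) (by omega))
          rwa [wordWeight_append, ← hnj] at this
        have h1 := hf.prod_mul_le hp (w (N + j) (by omega)) α
        rw [← hnj] at h1
        exact (mul_le_mul_of_nonneg_right (Finset.inf'_le q (Finset.mem_univ j)) h0).trans h1
      -- For a gap above N + M, average over one step: each step shortens the gap by at most M, so
      -- it stays at least N and induction applies with the same constant.
      · rw [hf.harmonic α, ← one_mul (Finset.univ.inf' hne q * f n), ← hsum, Finset.sum_mul]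
        refine Finset.sum_le_sum fun k _ => mul_le_mul_of_nonneg_left ?_ (hp k).le
        have h1 := hpos k
        have h2 := le_maxWeight (L := L) k
        have := ih (i - L k) (by omega) (α ++ [k])
          (by simp only [wordWeight_append, wordWeight_cons, wordWeight_nil]; omega)
          (by simp only [wordWeight_append, wordWeight_cons, wordWeight_nil]; omega)
        simpa using this

/-- Harmonicity expresses a value as an average of values at strictly larger weights, so an upper
bound near infinity propagates down. -/
lemma IsNonnegHarmonic.le_of_forall_ge_le {f : ℕ → ℝ} (hf : IsNonnegHarmonic L p f)
    (hp : ∀ k, 0 < p k) (hsum : ∑ k, p k = 1) (hpos : ∀ i, 0 < L i) {N : ℕ} {ε : ℝ}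
    (h : ∀ n ≥ N, f n ≤ ε) (α : List (Fin d)) : f (wordWeight L α) ≤ ε := by
  obtain ⟨i, hi⟩ : ∃ i, N - wordWeight L α = i := ⟨_, rfl⟩
  induction i using Nat.strong_induction_on generalizing α with
  | _ i ih =>
    by_cases h0 : N ≤ wordWeight L α
    · exact h _ h0
    · rw [hf.harmonic α, ← one_mul ε, ← hsum, Finset.sum_mul]
      refine Finset.sum_le_sum fun k _ => mul_le_mul_of_nonneg_left ?_ (hp k).le
      have h1 := hpos k
      have := ih (i - L k) (by omega) (α ++ [k])
        (by simp only [wordWeight_append, wordWeight_cons, wordWeight_nil]; omega)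
      simpa using this

/-- Nonnegative harmonic functions are constant. -/
lemma IsNonnegHarmonic.eq_apply_zero {f : ℕ → ℝ} (hf : IsNonnegHarmonic L p f)
    (hp : ∀ k, 0 < p k) (hsum : ∑ k, p k = 1) (hpos : ∀ i, 0 < L i)
    (hgcd : Finset.univ.gcd L = 1) (α : List (Fin d)) : f (wordWeight L α) = f 0 := by
  set m := ⨅ α, f (wordWeight L α) with hm
  have hbdd : BddBelow (Set.range fun α => f (wordWeight L α)) :=
    ⟨0, by rintro _ ⟨α, rfl⟩; exact hf.nonneg α⟩
  have hg : IsNonnegHarmonic L p fun n => f n - m := by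
    refine ⟨fun α => sub_nonneg.2 (ciInf_le hbdd α), fun α => ?_⟩
    simp only [mul_sub, Finset.sum_sub_distrib]
    rw [← hf.harmonic, ← Finset.sum_mul, hsum, one_mul]
  obtain ⟨K, c, hc, hK⟩ := exists_harnack hp hsum hpos hgcd
  have key (α : List (Fin d)) : f (wordWeight L α) = m := by
    refine le_antisymm ?_ (ciInf_le hbdd α)
    rw [← sub_nonpos]
    refine le_of_forall_pos_le_add fun ε hε => ?_
    -- Apply Harnack to f - m at a word γ where it is below cε: the constant c cancels and f - m ≤ ε
    -- at all large n, hence at every weight.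
    obtain ⟨γ, hγ⟩ := exists_lt_of_ciInf_lt (show m < m + c * ε by nlinarith)
    have h := hg.le_of_forall_ge_le hp hsum hpos (N := wordWeight L γ + K) (ε := ε) ?_ α
    · simpa using h
    · intro n hn
      have := hK _ hg γ n hn
      have h2 : c * (f n - m) ≤ c * ε := by linarith
      exact le_of_mul_le_mul_left h2 hc
  rw [key α]
  exact (key []).symm

end Harmonic

/-! ### The words at the nodes of the diagram -/

section BlockWords

variable {d : ℕ} {L : Fin d → ℕ}

/-- The words labelling the rows and columns of the matrix algebra at the node `(n, m)`. -/
def blockWords (L : Fin d → ℕ) : ℕ → ℕ → Finset (List (Fin d))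
  | 0, m => if m = 0 then {[]} else ∅
  | n + 1, m => blockWords L n (m + 1) ∪
      ((blockWords L n 0) ×ˢ (Finset.univ.filter fun k => L k = m + 1)).image
        fun x => x.1 ++ [x.2]

lemma mem_blockWords_succ {n m : ℕ} {α : List (Fin d)} :
    α ∈ blockWords L (n + 1) m ↔ α ∈ blockWords L n (m + 1) ∨
      ∃ γ ∈ blockWords L n 0, ∃ k, L k = m + 1 ∧ γ ++ [k] = α := by
  simp only [blockWords, Finset.mem_union, Finset.mem_image, Finset.mem_product, Finset.mem_filter,
    Finset.mem_univ, true_and, Prod.exists]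
  refine or_congr Iff.rfl ⟨?_, ?_⟩
  · rintro ⟨γ, k, ⟨h₁, h₂⟩, h₃⟩
    exact ⟨γ, h₁, k, h₂, h₃⟩
  · rintro ⟨γ, h₁, k, h₂, h₃⟩
    exact ⟨γ, k, ⟨h₁, h₂⟩, h₃⟩

/-- A word belongs to the node `(n, m)` if it is the shortest prefix of weight at least `n` of its
extensions, and has weight `n + m`. -/
lemma mem_blockWords (hpos : ∀ i, 0 < L i) {n m : ℕ} {α : List (Fin d)} :
    α ∈ blockWords L n m ↔
      wordWeight L α = n + m ∧ (α = [] ∨ wordWeight L α.dropLast < n) := by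
  induction n generalizing m α with
  | zero =>
    rcases List.eq_nil_or_concat α with rfl | ⟨γ, k, rfl⟩
    · by_cases h : m = 0 <;> simp [blockWords, h, eq_comm]
    · by_cases h : m = 0 <;> simp [blockWords, h]
  | succ n ih =>
    rw [mem_blockWords_succ]
    simp only [ih]
    constructor
    · rintro (⟨h₁, h₂⟩ | ⟨γ, ⟨h₁, h₂⟩, k, h₃, rfl⟩)
      · exact ⟨by omega, h₂.imp_right (by omega)⟩
      · refine ⟨by simp; omega, Or.inr (by simp; omega)⟩
    · rintro ⟨h₁, h₂⟩
      rcases List.eq_nil_or_concat α with rfl | ⟨γ, k, rfl⟩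
      · simp at h₁
        omega
      · simp only [List.concat_eq_append, wordWeight_append, wordWeight_cons, wordWeight_nil,
          List.append_eq_nil_iff, List.dropLast_concat, add_zero] at h₁ h₂ ⊢
        replace h₂ : wordWeight L γ < n + 1 := by simpa using h₂
        by_cases h : wordWeight L γ < n
        · exact Or.inl ⟨by omega, Or.inr h⟩
        · refine Or.inr ⟨γ, ⟨by omega, ?_⟩, k, by omega, rfl⟩
          rcases List.eq_nil_or_concat γ with rfl | ⟨δ, j, rfl⟩
          · exact Or.inl rfl
          · have := hpos j
            simp at h h₂ ⊢
            omega

/-- Places every word in the row numbered by its weight, so each balanced pair of words lies in a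
common block. -/
lemma mem_blockWords_zero (hpos : ∀ i, 0 < L i) (α : List (Fin d)) :
    α ∈ blockWords L (wordWeight L α) 0 := by
  rw [mem_blockWords hpos]
  refine ⟨rfl, ?_⟩
  rcases List.eq_nil_or_concat α with rfl | ⟨δ, j, rfl⟩
  · exact Or.inl rfl
  · have := hpos j
    right
    simpa using this

lemma lt_maxWeight_of_mem_blockWords (hd : 0 < d) (hpos : ∀ i, 0 < L i) {n m : ℕ}
    {α : List (Fin d)} (h : α ∈ blockWords L n m) : m < maxWeight L := by
  obtain ⟨h₁, h₂⟩ := (mem_blockWords hpos).1 h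
  rcases List.eq_nil_or_concat α with rfl | ⟨γ, k, rfl⟩
  · have := maxWeight_pos hd hpos
    simp at h₁
    omega
  · have := le_maxWeight (L := L) k
    simp at h₁ h₂
    omega

/-- The words of a row form a prefix code. -/
lemma eq_of_prefix_of_mem_blockWords (hpos : ∀ i, 0 < L i) {n m m' : ℕ} {α γ : List (Fin d)}
    (hα : α ∈ blockWords L n m) (hγ : γ ∈ blockWords L n m') (h : α <+: γ) : α = γ := by
  obtain ⟨h₁, -⟩ := (mem_blockWords hpos).1 hα
  obtain ⟨-, h₂⟩ := (mem_blockWords hpos).1 hγ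
  obtain ⟨δ, rfl⟩ := h
  rcases List.eq_nil_or_concat δ with rfl | ⟨ε, k, rfl⟩
  · simp
  -- For a proper extension γ of α, removing the last letter of γ still leaves α as a prefix, hence
  -- weight at least n; this contradicts membership in row n.
  · rw [List.concat_eq_append, ← List.append_assoc] at h₂
    simp at h₂
    omega

lemma card_blockWords_succ (hpos : ∀ i, 0 < L i) (n m : ℕ) :
    (blockWords L (n + 1) m).card = (blockWords L n (m + 1)).card +
      (blockWords L n 0).card * (Finset.univ.filter fun k => L k = m + 1).card := by
  rw [blockWords, Finset.card_union_of_disjoint, Finset.card_image_of_injective,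
    Finset.card_product]
  · rintro ⟨α, k⟩ ⟨γ, j⟩ h
    simpa using h
  -- A word coming from an extension has weight exactly n before its last letter; a word already
  -- present in row n has less.
  · rw [Finset.disjoint_left]
    intro α hα hα'
    simp only [Finset.mem_image, Finset.mem_product, Finset.mem_filter, Finset.mem_univ, true_and,
      Prod.exists] at hα'
    obtain ⟨γ, k, ⟨hγ, hk⟩, rfl⟩ := hα'
    have h₁ := ((mem_blockWords hpos).1 hα).2
    have h₂ := ((mem_blockWords hpos).1 hγ).1
    simp at h₁
    omega

lemma blockWords_eq_empty (hd : 0 < d) (hpos : ∀ i, 0 < L i) {n m : ℕ} (h : maxWeight L ≤ m) :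
    blockWords L n m = ∅ :=
  Finset.eq_empty_of_forall_notMem fun _ hα =>
    absurd (lt_maxWeight_of_mem_blockWords hd hpos hα) (not_lt.2 h)

lemma card_blockWords (hd : 0 < d) (hpos : ∀ i, 0 < L i) (n : ℕ) (m : Fin (maxWeight L)) :
    (blockWords L n m).card = nodeDim L n m := by
  induction n generalizing m with
  | zero => by_cases h : m.val = 0 <;> simp [blockWords, nodeDim, h]
  | succ n ih =>
    have h0 := maxWeight_pos hd hpos
    rw [card_blockWords_succ hpos]
    simp only [nodeDim, Matrix.mulVec, dotProduct, ← ih]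
    -- Column 0 of J counts the extensions. Among the others only column m + 1 contributes, and it
    -- is absent when m is the top node.
    rw [← Finset.add_sum_erase _ _ (Finset.mem_univ (⟨0, h0⟩ : Fin (maxWeight L))), add_comm,
      mul_comm]
    congr 1
    by_cases h : m.val + 1 < maxWeight L
    · rw [Finset.sum_eq_single ⟨m.val + 1, h⟩]
      · simp [incidenceMatrix]
      · intro v hv hne
        have hv0 : v.val ≠ 0 := fun h' => (Finset.mem_erase.1 hv).1 (Fin.ext h')
        have hv1 : v.val ≠ m.val + 1 := fun h' => hne (Fin.ext h')
        simp [incidenceMatrix, hv0, hv1]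
      · intro hn
        exact absurd (Finset.mem_erase.2 ⟨by simp [Fin.ext_iff], Finset.mem_univ _⟩) hn
    · rw [blockWords_eq_empty hd hpos (not_lt.1 h), Finset.card_empty]
      refine (Finset.sum_eq_zero fun v hv => ?_).symm
      have hv0 : v.val ≠ 0 := fun h' => (Finset.mem_erase.1 hv).1 (Fin.ext h')
      have hv1 : v.val ≠ m.val + 1 := by have := v.2; omega
      simp [incidenceMatrix, hv0, hv1]

end BlockWords

/-! ### Matrix units -/

/-- A system of matrix units for `⨁ᵥ M_{ι v}(ℂ)` in a C⋆-algebra. -/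
structure IsMatrixUnits {C : Type*} [CStarAlgebra C] {V : Type*} [Fintype V] {ι : V → Type*}
    [∀ v, Fintype (ι v)] (e : ∀ v, ι v → ι v → C) : Prop where
  star_eq : ∀ v a b, star (e v a b) = e v b a
  mul_eq : ∀ v a b c, e v a b * e v b c = e v a c
  mul_eq_zero : ∀ v a b b' c, b ≠ b' → e v a b * e v b' c = 0
  mul_eq_zero_of_ne : ∀ v w, v ≠ w → ∀ a b a' b', e v a b * e w a' b' = 0
  sum_eq_one : ∑ v, ∑ a, e v a a = 1
  ne_zero : ∀ v a, e v a a ≠ 0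

namespace IsMatrixUnits

variable {C : Type*} [CStarAlgebra C] {V : Type*} [Fintype V] {ι : V → Type*}
  [∀ v, Fintype (ι v)] {e : ∀ v, ι v → ι v → C}

lemma mul_sum (h : IsMatrixUnits e) (N : ∀ v, Matrix (ι v) (ι v) ℂ) (v : V) (a b : ι v) :
    e v a b * ∑ w, ∑ c, ∑ c', N w c c' • e w c c' = ∑ c, N v b c • e v a c := by
  rw [Finset.mul_sum, Finset.sum_eq_single v, Finset.mul_sum, Finset.sum_eq_single b,
    Finset.mul_sum]
  · exact Finset.sum_congr rfl fun c _ => by rw [mul_smul_comm, h.mul_eq]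
  · intro c _ hc
    rw [Finset.mul_sum]
    exact Finset.sum_eq_zero fun c' _ => by
      rw [mul_smul_comm, h.mul_eq_zero v a b c c' hc.symm, smul_zero]
  · simp
  · intro w _ hw
    simp only [Finset.mul_sum]
    exact Finset.sum_eq_zero fun c _ => Finset.sum_eq_zero fun c' _ => by
      rw [mul_smul_comm, h.mul_eq_zero_of_ne v w hw.symm, smul_zero]
  · simp

variable [∀ v, DecidableEq (ι v)]

/-- The ⋆-homomorphism defined by a system of matrix units. -/
noncomputable def hom (h : IsMatrixUnits e) : (∀ v, Matrix (ι v) (ι v) ℂ) →⋆ₐ[ℂ] C where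
  toFun M := ∑ v, ∑ a, ∑ b, M v a b • e v a b
  map_one' := by
    rw [← h.sum_eq_one]
    refine Finset.sum_congr rfl fun v _ => Finset.sum_congr rfl fun a _ => ?_
    rw [Finset.sum_eq_single a]
    · simp
    · intro b _ hb
      simp [hb.symm]
    · simp
  map_mul' M N := by
    simp only [Finset.sum_mul, smul_mul_assoc, h.mul_sum]
    refine Finset.sum_congr rfl fun v _ => Finset.sum_congr rfl fun a _ => ?_
    simp only [Pi.mul_apply, Matrix.mul_apply, Finset.sum_smul, Finset.smul_sum, smul_smul]
    exact Finset.sum_comm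
  map_zero' := by simp
  map_add' M N := by simp [add_smul, Finset.sum_add_distrib]
  commutes' r := by
    rw [Algebra.algebraMap_eq_smul_one, Algebra.algebraMap_eq_smul_one, ← h.sum_eq_one,
      Finset.smul_sum]
    refine Finset.sum_congr rfl fun v _ => ?_
    rw [Finset.smul_sum]
    refine Finset.sum_congr rfl fun a _ => ?_
    rw [Finset.sum_eq_single a]
    · simp
    · intro b _ hb
      simp [hb.symm]
    · simp
  map_star' M := by
    simp only [star_sum, star_smul, h.star_eq, Pi.star_apply, Matrix.star_apply]
    exact Finset.sum_congr rfl fun v _ => Finset.sum_comm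

lemma hom_apply (h : IsMatrixUnits e) (M : ∀ v, Matrix (ι v) (ι v) ℂ) :
    h.hom M = ∑ v, ∑ a, ∑ b, M v a b • e v a b := rfl

lemma mul_hom_mul (h : IsMatrixUnits e) (M : ∀ v, Matrix (ι v) (ι v) ℂ) (v : V)
    (a b c c' : ι v) : e v a b * h.hom M * e v c c' = M v b c • e v a c' := by
  rw [hom_apply, h.mul_sum, Finset.sum_mul, Finset.sum_eq_single c]
  · rw [smul_mul_assoc, h.mul_eq]
  · intro b' _ hb
    rw [smul_mul_assoc, h.mul_eq_zero v a b' c c' hb, smul_zero]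
  · simp

/-- Compressing by matrix units recovers every coefficient as a multiple of a nonzero diagonal unit.
-/
lemma hom_injective (h : IsMatrixUnits e) : Function.Injective h.hom := by
  rw [injective_iff_map_eq_zero]
  intro M hM
  funext v
  ext a b
  have h1 := h.mul_hom_mul M v a a b a
  rw [hM, mul_zero, zero_mul] at h1
  exact (smul_eq_zero.1 h1.symm).resolve_right (h.ne_zero v a)

lemma hom_single [DecidableEq V] (h : IsMatrixUnits e) (v : V) (a b : ι v) (z : ℂ) :
    h.hom (Pi.single v (Matrix.single a b z)) = z • e v a b := by
  rw [hom_apply, Finset.sum_eq_single v, Finset.sum_eq_single a, Finset.sum_eq_single b]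
  · simp
  · intro c _ hc
    simp [hc.symm]
  · simp
  · intro c _ hc
    simp [hc.symm]
  · simp
  · intro w _ hw
    simp [Pi.single_eq_of_ne hw]
  · simp

end IsMatrixUnits

lemma HasBratteliDiagram.isAFAlgebra {A : Type*} [CStarAlgebra A] {D : BratteliDiagram}
    (h : HasBratteliDiagram A D) : IsAFAlgebra A := by
  obtain ⟨B, hB, φ, hdense, -⟩ := h
  refine ⟨fun n => (B n).toNonUnitalStarSubalgebra,
    monotone_nat_of_le_succ fun n x hx => hB n hx, fun n => ?_, hdense⟩
  exact LinearEquiv.finiteDimensional (V₂ := B n) ((φ n).symm.toAlgEquiv).toLinearEquiv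

/-! ### Matrix units indexed by words -/

/-- The relations of the elements `E α γ = s_α s_γ*` with `α`, `γ` of equal weight, and the density
of their span. -/
structure IsWordUnits {d : ℕ} (L : Fin d → ℕ) {C : Type*} [CStarAlgebra C]
    (E : List (Fin d) → List (Fin d) → C) : Prop where
  star_eq : ∀ α γ, star (E α γ) = E γ α
  mul_eq : ∀ α γ δ, wordWeight L α = wordWeight L γ → wordWeight L γ = wordWeight L δ →
    E α γ * E γ δ = E α δ
  mul_eq_zero : ∀ α γ δ ε, ¬ γ <+: δ → ¬ δ <+: γ → E α γ * E δ ε = 0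
  nil_eq_one : E [] [] = 1
  sum_eq : ∀ α γ, wordWeight L α = wordWeight L γ → ∑ k, E (α ++ [k]) (γ ++ [k]) = E α γ
  dense : Dense (Submodule.span ℂ
    {x | ∃ α γ, wordWeight L α = wordWeight L γ ∧ E α γ = x} : Set C)
  ne_zero : ∀ α, E α α ≠ 0

/-! ### Sums over a row and passage to the next row -/

section RowSum

variable {d : ℕ} {L : Fin d → ℕ} {G : Type*} [AddCommMonoid G]

/-- The sum over all words of a row. -/
def rowSum (L : Fin d → ℕ) (g : List (Fin d) → G) (n : ℕ) : G :=
  ∑ m : Fin (maxWeight L), ∑ α ∈ blockWords L n m, g α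

lemma rowSum_zero (hd : 0 < d) (hpos : ∀ i, 0 < L i) (g : List (Fin d) → G) :
    rowSum L g 0 = g [] := by
  rw [rowSum, Finset.sum_eq_single ⟨0, maxWeight_pos hd hpos⟩]
  · simp [blockWords]
  · intro m _ hm
    have : m.val ≠ 0 := fun h => hm (Fin.ext h)
    simp [blockWords, this]
  · simp

/-- Only words of weight exactly n are replaced on the way to row n + 1, so additivity of g under
one-letter extension is needed for those words alone. -/
lemma rowSum_succ (hd : 0 < d) (hpos : ∀ i, 0 < L i) (g : List (Fin d) → G) (n : ℕ)
    (h : ∀ γ ∈ blockWords L n 0, ∑ k, g (γ ++ [k]) = g γ) :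
    rowSum L g (n + 1) = rowSum L g n := by
  have h1 (m : ℕ) : ∑ α ∈ blockWords L (n + 1) m, g α = ∑ α ∈ blockWords L n (m + 1), g α +
      ∑ γ ∈ blockWords L n 0, ∑ k, if L k = m + 1 then g (γ ++ [k]) else 0 := by
    rw [blockWords, Finset.sum_union, Finset.sum_image, Finset.sum_product]
    · simp only [Finset.sum_filter]
    · rintro ⟨α, k⟩ _ ⟨γ, j⟩ _ h
      simpa using h
    · rw [Finset.disjoint_left]
      intro α hα hα'
      simp only [Finset.mem_image, Finset.mem_product, Finset.mem_filter, Finset.mem_univ,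
        true_and, Prod.exists] at hα'
      obtain ⟨γ, k, ⟨hγ, hk⟩, rfl⟩ := hα'
      have h₁ := ((mem_blockWords hpos).1 hα).2
      have h₂ := ((mem_blockWords hpos).1 hγ).1
      simp at h₁
      omega
  have h2 : ∑ m ∈ Finset.range (maxWeight L), ∑ γ ∈ blockWords L n 0,
      ∑ k, (if L k = m + 1 then g (γ ++ [k]) else 0) = ∑ γ ∈ blockWords L n 0, g γ := by
    rw [Finset.sum_comm]
    refine Finset.sum_congr rfl fun γ hγ => ?_
    rw [Finset.sum_comm, ← h γ hγ]
    refine Finset.sum_congr rfl fun k _ => ?_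
    have h3 := hpos k
    have h4 := le_maxWeight (L := L) k
    rw [Finset.sum_eq_single (L k - 1)]
    · rw [if_pos (by omega)]
    · intro m _ hm
      rw [if_neg (by omega)]
    · intro hm
      exact absurd (Finset.mem_range.2 (by omega)) hm
  -- The surviving words account for nodes 1, …, M of row n and the extensions for node 0; node M is
  -- empty.
  rw [rowSum, rowSum, ← Finset.sum_range fun m => ∑ α ∈ blockWords L (n + 1) m, g α,
    ← Finset.sum_range fun m => ∑ α ∈ blockWords L n m, g α]
  simp only [h1]
  rw [Finset.sum_add_distrib, h2, ← Finset.sum_range_succ' (fun m => ∑ α ∈ blockWords L n m, g α),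
    Finset.sum_range_succ, blockWords_eq_empty hd hpos le_rfl, Finset.sum_empty, add_zero]

lemma rowSum_eq_single (hpos : ∀ i, 0 < L i) (g : List (Fin d) → G) {n : ℕ}
    {m : Fin (maxWeight L)} {α : List (Fin d)} (hα : α ∈ blockWords L n m)
    (hg : ∀ γ, γ ≠ α → ∀ m, γ ∈ blockWords L n m → g γ = 0) : rowSum L g n = g α := by
  rw [rowSum, Finset.sum_eq_single m, Finset.sum_eq_single α]
  · exact fun γ hγ hne => hg γ hne _ hγ
  · exact fun h => absurd hα h
  · intro m' _ hm'
    refine Finset.sum_eq_zero fun γ hγ => hg γ ?_ _ hγ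
    rintro rfl
    have h1 := ((mem_blockWords hpos).1 hα).1
    have h2 := ((mem_blockWords hpos).1 hγ).1
    exact hm' (Fin.ext (by omega))
  · simp

end RowSum

/-! ### Words as indices of the matrix blocks -/

section Block

variable {d : ℕ} {L : Fin d → ℕ}

/-- An enumeration of the words at a node. -/
noncomputable def blockEquiv (hd : 0 < d) (hpos : ∀ i, 0 < L i) (n : ℕ)
    (v : (fixedPointDiagram L).V n) :
    Fin ((fixedPointDiagram L).dim n v) ≃ blockWords L n v.1 :=
  (Finset.equivFinOfCardEq (card_blockWords hd hpos n v.1)).symm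

lemma sum_blockEquiv {G : Type*} [AddCommMonoid G] (hd : 0 < d) (hpos : ∀ i, 0 < L i) (n : ℕ)
    (v : (fixedPointDiagram L).V n) (g : List (Fin d) → G) :
    ∑ a, g (blockEquiv hd hpos n v a) = ∑ α ∈ blockWords L n v.1, g α := by
  rw [Equiv.sum_comp (blockEquiv hd hpos n v) fun x => g x.1]
  exact Finset.sum_coe_sort _ _

lemma sum_node_eq_rowSum {G : Type*} [AddCommMonoid G] (hd : 0 < d) (hpos : ∀ i, 0 < L i)
    (n : ℕ) (g : List (Fin d) → G) :
    ∑ v, ∑ a, g (blockEquiv hd hpos n v a) = rowSum L g n := by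
  simp only [sum_blockEquiv]
  rw [rowSum, ← Finset.sum_filter_of_ne (p := fun v => nodeDim L n v ≠ 0)]
  · exact (Finset.sum_subtype (Finset.univ.filter fun v => nodeDim L n v ≠ 0)
      (fun v => by simp) fun m => ∑ α ∈ blockWords L n m, g α).symm
  · intro m _ h h0
    rw [← card_blockWords hd hpos, Finset.card_eq_zero] at h0
    rw [h0, Finset.sum_empty] at h
    exact h rfl

lemma exists_blockEquiv_eq (hd : 0 < d) (hpos : ∀ i, 0 < L i) {n m : ℕ} {α : List (Fin d)}
    (hα : α ∈ blockWords L n m) :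
    ∃ v : (fixedPointDiagram L).V n, v.1.val = m ∧
      ∀ γ ∈ blockWords L n m, ∃ a, (blockEquiv hd hpos n v a : List (Fin d)) = γ := by
  have hm := lt_maxWeight_of_mem_blockWords hd hpos hα
  refine ⟨⟨⟨m, hm⟩, ?_⟩, rfl, fun γ hγ => ?_⟩
  · rw [← card_blockWords hd hpos]
    exact (Finset.card_pos.2 ⟨α, hα⟩).ne'
  · exact ⟨(blockEquiv hd hpos n _).symm ⟨γ, hγ⟩, by rw [Equiv.apply_symm_apply]⟩

/-- The number of words of a node of row `n + 1` which extend a given word of row `n`. -/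
lemma card_filter_prefix_blockWords (hpos : ∀ i, 0 < L i) {n : ℕ} {v w : Fin (maxWeight L)}
    {α : List (Fin d)} (hα : α ∈ blockWords L n v) :
    ((blockWords L (n + 1) w).filter (α <+: ·)).card = incidenceMatrix L w v := by
  have hw := (mem_blockWords hpos).1 hα
  by_cases hv : v.val = 0
  · have : (blockWords L (n + 1) w).filter (α <+: ·) =
        (Finset.univ.filter fun k => L k = w.val + 1).image fun k => α ++ [k] := by
      ext δ
      simp only [Finset.mem_filter, Finset.mem_image, Finset.mem_univ, true_and,
        mem_blockWords_succ]
      constructor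
      · rintro ⟨h | ⟨γ, hγ, k, hk, rfl⟩, hp⟩
        · have := eq_of_prefix_of_mem_blockWords hpos hα h hp
          subst this
          have := ((mem_blockWords hpos).1 h).1
          omega
        · refine ⟨k, hk, ?_⟩
          rcases List.prefix_concat_iff.1 hp with h | h
          · have := hpos k
            subst h
            have := ((mem_blockWords hpos).1 hγ).1
            simp at hw
            omega
          · rw [eq_of_prefix_of_mem_blockWords hpos hα hγ h]
      · rintro ⟨k, hk, rfl⟩
        rw [hv] at hα
        exact ⟨Or.inr ⟨α, hα, k, hk, rfl⟩, List.prefix_append _ _⟩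
    rw [this, Finset.card_image_of_injective _ fun k j h => by simpa using h, incidenceMatrix,
      if_pos hv]
  · rw [incidenceMatrix, if_neg hv]
    -- A word at node v > 0 persists to row n + 1 at node v - 1, so by the prefix code property its
    -- only extension there is itself.
    have key : ∀ δ ∈ blockWords L (n + 1) w, α <+: δ → α = δ := by
      intro δ hδ hp
      refine eq_of_prefix_of_mem_blockWords hpos (n := n + 1) (m := v.val - 1) ?_ hδ hp
      refine mem_blockWords_succ.2 (Or.inl ?_)
      rwa [Nat.sub_add_cancel (Nat.pos_of_ne_zero hv)]
    split_ifs with h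
    · rw [Finset.card_eq_one]
      refine ⟨α, ?_⟩
      ext δ
      simp only [Finset.mem_filter, Finset.mem_singleton]
      constructor
      · rintro ⟨h1, h2⟩
        exact (key δ h1 h2).symm
      · rintro rfl
        exact ⟨mem_blockWords_succ.2 (Or.inl (h ▸ hα)), List.prefix_rfl⟩
    · rw [Finset.card_eq_zero, Finset.filter_eq_empty_iff]
      intro δ hδ hp
      have := key δ hδ hp
      subst this
      have := ((mem_blockWords hpos).1 hδ).1
      omega

end Block

/-! ### The Bratteli diagram from the word units -/

namespace IsWordUnits

variable {d : ℕ} {L : Fin d → ℕ} {C : Type*} [CStarAlgebra C]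
  {E : List (Fin d) → List (Fin d) → C}

lemma mul_eq_zero_of_mem (h : IsWordUnits L E) (hpos : ∀ i, 0 < L i) {n m m' : ℕ}
    {γ δ : List (Fin d)} (hγ : γ ∈ blockWords L n m) (hδ : δ ∈ blockWords L n m') (hne : γ ≠ δ)
    (α ε : List (Fin d)) : E α γ * E δ ε = 0 :=
  h.mul_eq_zero _ _ _ _ (fun hp => hne (eq_of_prefix_of_mem_blockWords hpos hγ hδ hp))
    fun hp => hne (eq_of_prefix_of_mem_blockWords hpos hδ hγ hp).symm

lemma rowSum_eq_one (h : IsWordUnits L E) (hd : 0 < d) (hpos : ∀ i, 0 < L i) (n : ℕ) :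
    rowSum L (fun α => E α α) n = 1 := by
  induction n with
  | zero => rw [rowSum_zero hd hpos, h.nil_eq_one]
  | succ n ih => rw [rowSum_succ hd hpos _ _ fun γ _ => h.sum_eq γ γ rfl, ih]

/-- Words at one node share their weight, which gives the products within a block. Distinct words of
the row are prefix-incomparable, which gives orthogonality. -/
lemma isMatrixUnits (h : IsWordUnits L E) (hd : 0 < d) (hpos : ∀ i, 0 < L i) (n : ℕ) :
    IsMatrixUnits (V := (fixedPointDiagram L).V n)
      (ι := fun v => Fin ((fixedPointDiagram L).dim n v))
      fun v a b => E (blockEquiv hd hpos n v a) (blockEquiv hd hpos n v b) where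
  star_eq _ _ _ := h.star_eq _ _
  mul_eq v a b c := by
    have hw (a) : wordWeight L (blockEquiv hd hpos n v a) = n + v.1.val :=
      ((mem_blockWords hpos).1 (blockEquiv hd hpos n v a).2).1
    exact h.mul_eq _ _ _ ((hw a).trans (hw b).symm) ((hw b).trans (hw c).symm)
  mul_eq_zero v a b b' c hb :=
    h.mul_eq_zero_of_mem hpos (blockEquiv hd hpos n v b).2 (blockEquiv hd hpos n v b').2
      (fun h' => hb ((blockEquiv hd hpos n v).injective (Subtype.ext h'))) _ _
  mul_eq_zero_of_ne v w hvw a b a' b' := by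
    refine h.mul_eq_zero_of_mem hpos (blockEquiv hd hpos n v b).2 (blockEquiv hd hpos n w a').2
      (fun h' => hvw (Subtype.ext (Fin.ext ?_))) _ _
    have h1 := ((mem_blockWords hpos).1 (blockEquiv hd hpos n v b).2).1
    have h2 := ((mem_blockWords hpos).1 (blockEquiv hd hpos n w a').2).1
    rw [h'] at h1
    omega
  sum_eq_one := (sum_node_eq_rowSum hd hpos n fun α => E α α).trans (h.rowSum_eq_one hd hpos n)
  ne_zero _ _ := h.ne_zero _

/-- The embedding of the algebra of row `n`. -/
noncomputable def rowHom (h : IsWordUnits L E) (hd : 0 < d) (hpos : ∀ i, 0 < L i) (n : ℕ) :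
    (fixedPointDiagram L).RowAlgebra n →⋆ₐ[ℂ] C :=
  (h.isMatrixUnits hd hpos n).hom

lemma rowHom_apply (h : IsWordUnits L E) (hd : 0 < d) (hpos : ∀ i, 0 < L i) (n : ℕ)
    (M : (fixedPointDiagram L).RowAlgebra n) :
    h.rowHom hd hpos n M =
      ∑ v, ∑ a, ∑ b, M v a b • E (blockEquiv hd hpos n v a) (blockEquiv hd hpos n v b) := rfl

lemma E_mem_range_rowHom (h : IsWordUnits L E) (hd : 0 < d) (hpos : ∀ i, 0 < L i) {n m : ℕ}
    {α γ : List (Fin d)} (hα : α ∈ blockWords L n m) (hγ : γ ∈ blockWords L n m) :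
    E α γ ∈ (h.rowHom hd hpos n).range := by
  obtain ⟨v, -, hv⟩ := exists_blockEquiv_eq hd hpos hα
  obtain ⟨a, ha⟩ := hv α hα
  obtain ⟨b, hb⟩ := hv γ hγ
  refine ⟨Pi.single v (Matrix.single a b 1), ?_⟩
  refine ((h.isMatrixUnits hd hpos n).hom_single v a b 1).trans ?_
  rw [one_smul, ha, hb]

/-- A unit at node m > 0 reappears at node m - 1. At node 0 it is the sum of E (αk) (γk), whose two
words both sit at node L_k - 1. -/
lemma range_rowHom_le (h : IsWordUnits L E) (hd : 0 < d) (hpos : ∀ i, 0 < L i) (n : ℕ) :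
    (h.rowHom hd hpos n).range ≤ (h.rowHom hd hpos (n + 1)).range := by
  rintro _ ⟨M, rfl⟩
  change h.rowHom hd hpos n M ∈ _
  rw [rowHom_apply]
  refine sum_mem fun v _ => sum_mem fun a _ => sum_mem fun b _ => StarSubalgebra.smul_mem _ ?_ _
  have ha := (blockEquiv hd hpos n v a).2
  have hb := (blockEquiv hd hpos n v b).2
  generalize (blockEquiv hd hpos n v a : List (Fin d)) = α at ha ⊢
  generalize (blockEquiv hd hpos n v b : List (Fin d)) = γ at hb ⊢
  generalize v.1.val = m at ha hb
  rcases Nat.eq_zero_or_pos m with rfl | h0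
  · rw [← h.sum_eq]
    · refine sum_mem fun k _ => h.E_mem_range_rowHom hd hpos (m := L k - 1) ?_ ?_ <;>
        refine mem_blockWords_succ.2 (Or.inr ⟨_, ‹_›, k, ?_, rfl⟩) <;> have := hpos k <;> omega
    · rw [((mem_blockWords hpos).1 ha).1, ((mem_blockWords hpos).1 hb).1]
  · refine h.E_mem_range_rowHom hd hpos (m := m - 1) ?_ ?_ <;>
      refine mem_blockWords_succ.2 (Or.inl ?_) <;> rwa [Nat.sub_add_cancel h0]

lemma dense_iUnion_range_rowHom (h : IsWordUnits L E) (hd : 0 < d) (hpos : ∀ i, 0 < L i) :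
    Dense (⋃ n, ((h.rowHom hd hpos n).range : Set C)) := by
  refine h.dense.mono ?_
  have hmono : Monotone fun n =>
      Subalgebra.toSubmodule (h.rowHom hd hpos n).range.toSubalgebra :=
    monotone_nat_of_le_succ fun n => h.range_rowHom_le hd hpos n
  have hle : Submodule.span ℂ {x | ∃ α γ, wordWeight L α = wordWeight L γ ∧ E α γ = x} ≤
      ⨆ n, Subalgebra.toSubmodule (h.rowHom hd hpos n).range.toSubalgebra := by
    rw [Submodule.span_le]
    rintro _ ⟨α, γ, hw, rfl⟩
    refine Submodule.mem_iSup_of_mem (wordWeight L α) ?_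
    exact h.E_mem_range_rowHom hd hpos (mem_blockWords_zero hpos α)
      (hw ▸ mem_blockWords_zero hpos γ)
  intro x hx
  obtain ⟨n, hn⟩ := (Submodule.mem_iSup_of_directed _ hmono.directed_le).1 (hle hx)
  exact Set.mem_iUnion.2 ⟨n, hn⟩

/-- The image in row `n + 1` of a minimal projection of row `n`. -/
lemma rowHom_diagonal (h : IsWordUnits L E) (hd : 0 < d) (hpos : ∀ i, 0 < L i) {n : ℕ}
    {m : Fin (maxWeight L)} {α : List (Fin d)} (hα : α ∈ blockWords L n m) :
    h.rowHom hd hpos (n + 1) (fun w => Matrix.diagonal fun b =>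
      if α <+: (blockEquiv hd hpos (n + 1) w b : List (Fin d)) then 1 else 0) = E α α := by
  set g : List (Fin d) → C := fun δ => if α <+: δ then E δ δ else 0 with hg
  have h1 : h.rowHom hd hpos (n + 1) (fun w => Matrix.diagonal fun b =>
      if α <+: (blockEquiv hd hpos (n + 1) w b : List (Fin d)) then 1 else 0) =
      rowSum L g (n + 1) := by
    rw [← sum_node_eq_rowSum hd hpos, rowHom_apply]
    refine Finset.sum_congr rfl fun w _ => Finset.sum_congr rfl fun b _ => ?_
    rw [Finset.sum_eq_single b]
    · simp [hg]
    · intro b' _ hb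
      simp [Matrix.diagonal_apply_ne _ hb.symm]
    · simp
  -- The part of the row sum lying over α is unchanged when pulled back to row n, where α is the
  -- only word with prefix α.
  rw [h1, rowSum_succ hd hpos, rowSum_eq_single hpos g hα]
  · simp [hg]
  · intro γ hne m' hγ
    rw [hg]
    exact if_neg fun hp => hne (eq_of_prefix_of_mem_blockWords hpos hα hγ hp).symm
  · intro γ hγ
    by_cases hp : α <+: γ
    · simp only [hg, if_pos hp, if_pos (hp.trans (List.prefix_append _ _))]
      exact h.sum_eq γ γ rfl
    · simp only [hg, if_neg hp]
      refine Finset.sum_eq_zero fun k _ => if_neg fun hp' => ?_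
      rcases List.prefix_concat_iff.1 hp' with h' | h'
      · have := eq_of_prefix_of_mem_blockWords hpos hγ hα (h' ▸ List.prefix_append _ _)
        exact hp (this ▸ List.prefix_rfl)
      · exact hp h'

/-- In row n + 1 a minimal projection E α α becomes a 0-1 diagonal matrix whose ones mark the
extensions of α, so its rank in a block is the prefix count, an entry of J_L. -/
lemma hasBratteliDiagram (h : IsWordUnits L E) (hd : 0 < d) (hpos : ∀ i, 0 < L i) :
    HasBratteliDiagram C (fixedPointDiagram L) := by
  have hinj (n : ℕ) : Function.Injective (h.rowHom hd hpos n) :=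
    (h.isMatrixUnits hd hpos n).hom_injective
  refine ⟨fun n => (h.rowHom hd hpos n).range, h.range_rowHom_le hd hpos,
    fun n => (StarAlgEquiv.ofInjective _ (hinj n)).symm, h.dense_iUnion_range_rowHom hd hpos,
    fun n v a w => ?_⟩
  have hα := (blockEquiv hd hpos n v a).2
  have key : (StarAlgEquiv.ofInjective _ (hinj (n + 1))).symm
      (StarSubalgebra.inclusion (h.range_rowHom_le hd hpos n)
        ((StarAlgEquiv.ofInjective _ (hinj n)).symm.symm
          (Pi.single v (Matrix.single a a 1)))) =
      fun w => Matrix.diagonal fun b =>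
        if (blockEquiv hd hpos n v a : List (Fin d)) <+:
          (blockEquiv hd hpos (n + 1) w b : List (Fin d)) then 1 else 0 := by
    rw [← StarAlgEquiv.symm_apply_apply (StarAlgEquiv.ofInjective _ (hinj (n + 1)))
      (fun w => Matrix.diagonal fun b =>
        if (blockEquiv hd hpos n v a : List (Fin d)) <+:
          (blockEquiv hd hpos (n + 1) w b : List (Fin d)) then 1 else 0)]
    congr 1
    apply Subtype.ext
    refine Eq.trans ?_ (h.rowHom_diagonal hd hpos hα).symm
    exact ((h.isMatrixUnits hd hpos n).hom_single v a a 1).trans (one_smul _ _)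
  rw [key, Matrix.rank_diagonal]
  refine Eq.trans ?_ (card_filter_prefix_blockWords hpos hα)
  have h2 := sum_blockEquiv hd hpos (n + 1) w
    fun δ => if (blockEquiv hd hpos n v a : List (Fin d)) <+: δ then 1 else 0
  rw [← Finset.card_filter, ← Finset.card_filter] at h2
  rw [← h2, Fintype.card_subtype]
  congr 1
  ext b
  simp

end IsWordUnits

/-! ### States are continuous -/

lemma IsState.continuous {A : Type*} [CStarAlgebra A] {φ : A →ₗ[ℂ] ℂ} (hφ : IsState φ) :
    Continuous φ := by
  let _ : PartialOrder A := CStarAlgebra.spectralOrder A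
  have _ : StarOrderedRing A := CStarAlgebra.spectralOrderedRing A
  obtain ⟨c, hc⟩ := PositiveLinearMap.exists_norm_apply_le (PositiveLinearMap.mk₀ φ fun x hx => by
    obtain ⟨y, rfl⟩ := CStarAlgebra.nonneg_iff_eq_star_mul_self.1 hx
    exact hφ.1 y)
  exact AddMonoidHomClass.continuous_of_bound φ c hc

lemma LinearMap.ext_of_dense_span {A : Type*} [CStarAlgebra A] {φ ψ : A →ₗ[ℂ] ℂ} {S : Set A}
    (hφ : Continuous φ) (hψ : Continuous ψ) (hS : Dense (Submodule.span ℂ S : Set A))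
    (h : ∀ x ∈ S, φ x = ψ x) : φ = ψ := by
  refine DFunLike.coe_injective (hφ.ext_on hS hψ fun x hx => ?_)
  exact LinearMap.eqOn_span h hx

/-! ### Simplicity -/

/-- The element z = 1 - (e - eye) is invertible by a Neumann series and ez = eye, so e = eye z⁻¹
lies in the ideal. -/
lemma TwoSidedIdeal.mem_of_norm_sub_lt_one {A : Type*} [CStarAlgebra A] (I : TwoSidedIdeal A)
    {e y : A} (he : e * e = e) (hn : ‖e‖ ≤ 1) (hy : y ∈ I) (h : ‖e - y‖ < 1) : e ∈ I := by
  have h1 : ‖e - e * y * e‖ < 1 := by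
    have : e - e * y * e = e * (e - y) * e := by
      rw [mul_sub, sub_mul, he, he]
    rw [this]
    calc ‖e * (e - y) * e‖ ≤ ‖e‖ * ‖e - y‖ * ‖e‖ := norm_mul₃_le
      _ ≤ 1 * ‖e - y‖ * 1 := by gcongr
      _ < 1 := by simpa using h
  obtain ⟨z, hz⟩ := isUnit_one_sub_of_norm_lt_one h1
  have h2 : e = e * y * e * (↑z⁻¹ : A) := by
    have : e * (z : A) = e * y * e := by
      rw [hz, mul_sub, mul_sub, mul_one, he, ← mul_assoc, ← mul_assoc, he]
      abel
    rw [← this, mul_assoc, Units.mul_inv, mul_one]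
  rw [h2]
  exact I.mul_mem_right _ _ (I.mul_mem_right _ _ (I.mul_mem_left _ _ hy))

namespace IsMatrixUnits

variable {C : Type*} [CStarAlgebra C] {V : Type*} [Fintype V] {ι : V → Type*}
  [∀ v, Fintype (ι v)] {e : ∀ v, ι v → ι v → C}

lemma norm_le_one (h : IsMatrixUnits e) (v : V) (a : ι v) : ‖e v a a‖ ≤ 1 := by
  have h1 := CStarRing.norm_star_mul_self (x := e v a a)
  rw [h.star_eq, h.mul_eq] at h1
  nlinarith [norm_nonneg (e v a a)]

variable [∀ v, DecidableEq (ι v)]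

lemma hom_mul (h : IsMatrixUnits e) (M : ∀ v, Matrix (ι v) (ι v) ℂ) (v : V) (a b : ι v) :
    h.hom M * e v a b = ∑ c, M v c a • e v c b := by
  have h1 : h.hom M * e v a b = star (e v b a * h.hom (star M)) := by
    rw [star_mul, h.star_eq, map_star, star_star]
  rw [h1, hom_apply, h.mul_sum, star_sum]
  exact Finset.sum_congr rfl fun c _ => by
    rw [star_smul, h.star_eq, Pi.star_apply, Matrix.star_apply, star_star]

/-- The norm of a positive element of the span of a system of matrix units is attained on a
minimal projection. -/
lemma exists_star_mul_mul_eq [Nontrivial C] (h : IsMatrixUnits e)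
    (M : ∀ v, Matrix (ι v) (ι v) ℂ) :
    ∃ (v : V) (a : ι v) (u : C) (N : ℝ), 0 < N ∧ star u * u = (N : ℂ) • e v a a ∧
      star u * (star (h.hom M) * h.hom M) * u =
        ((‖star (h.hom M) * h.hom M‖ * N : ℝ) : ℂ) • e v a a := by
  set b := h.hom M with hb
  set r : ℝ := ‖star b * b‖ with hr
  have hH : star b * b = h.hom (star M * M) := by rw [hb, map_mul, map_star]
  -- The norm of a positive element lies in its spectrum. Homomorphisms do not enlarge spectra, so r
  -- is an eigenvalue of some block of M* M.
  have hspec : (r : ℂ) ∈ spectrum ℂ (h.hom (star M * M)) := by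
    let _ : PartialOrder C := CStarAlgebra.spectralOrder C
    have _ : StarOrderedRing C := CStarAlgebra.spectralOrderedRing C
    rw [← hH]
    exact spectrum.algebraMap_mem ℂ
      (CStarAlgebra.norm_mem_spectrum_of_nonneg (star_mul_self_nonneg b))
  have hspec' := AlgHom.spectrum_apply_subset h.hom (star M * M) hspec
  rw [Pi.spectrum_eq, Set.mem_iUnion] at hspec'
  obtain ⟨v, hv⟩ := hspec'
  rw [← Matrix.spectrum_toLin', ← Module.End.hasEigenvalue_iff_mem_spectrum] at hv
  obtain ⟨ξ, hξ⟩ := hv.exists_hasEigenvector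
  -- Any column a could carry the eigenvector ξ; one with ξ a ≠ 0 also shows that N = ‖ξ‖² is
  -- positive.
  obtain ⟨a, ha⟩ := Function.ne_iff.1 hξ.2
  have hξ' (c : ι v) : ∑ c', (star M * M) v c c' * ξ c' = r * ξ c := by
    have := congrFun hξ.apply_eq_smul c
    rwa [Matrix.toLin'_apply, Matrix.mulVec, dotProduct] at this
  set u : C := ∑ c, ξ c • e v c a with hu
  have huu : star u * u = ((∑ c, ‖ξ c‖ ^ 2 : ℝ) : ℂ) • e v a a := by
    rw [hu, star_sum, Finset.sum_mul, Complex.ofReal_sum, Finset.sum_smul]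
    refine Finset.sum_congr rfl fun c _ => ?_
    rw [Finset.mul_sum, Finset.sum_eq_single c]
    · rw [star_smul, smul_mul_smul_comm, h.star_eq, h.mul_eq, Complex.star_def,
        Complex.conj_mul', Complex.ofReal_pow]
    · intro c' _ hc
      rw [star_smul, smul_mul_smul_comm, h.star_eq, h.mul_eq_zero v a c c' a hc.symm, smul_zero]
    · simp
  have hbu : star b * b * u = (r : ℂ) • u := by
    rw [hH, hu, Finset.mul_sum, Finset.smul_sum]
    simp only [mul_smul_comm, h.hom_mul, Finset.smul_sum, smul_smul]
    rw [Finset.sum_comm]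
    refine Finset.sum_congr rfl fun c _ => ?_
    rw [← Finset.sum_smul, ← hξ' c]
    congr 1
    exact Finset.sum_congr rfl fun c' _ => mul_comm _ _
  refine ⟨v, a, u, ∑ c, ‖ξ c‖ ^ 2, ?_, huu, ?_⟩
  · have : 0 < ‖ξ a‖ := norm_pos_iff.2 ha
    exact Finset.sum_pos' (fun c _ => by positivity) ⟨a, Finset.mem_univ a, by positivity⟩
  · rw [mul_assoc, hbu, mul_smul_comm, huu, smul_smul, Complex.ofReal_mul]

end IsMatrixUnits

namespace IsWordUnits

variable {d : ℕ} {L : Fin d → ℕ} {C : Type*} [CStarAlgebra C]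
  {E : List (Fin d) → List (Fin d) → C}

lemma nontrivial (h : IsWordUnits L E) : Nontrivial C := ⟨_, _, h.ne_zero []⟩

lemma mul_self (h : IsWordUnits L E) (α : List (Fin d)) : E α α * E α α = E α α :=
  h.mul_eq α α α rfl rfl

/-- E (αk) (αk) is a subprojection of E α α, hence a multiple of it. -/
lemma E_append_mem (h : IsWordUnits L E) (I : TwoSidedIdeal C) {α : List (Fin d)}
    (hα : E α α ∈ I) (γ : List (Fin d)) : E (α ++ γ) (α ++ γ) ∈ I := by
  induction γ generalizing α with
  | nil => simpa using hα
  | cons k γ ih =>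
    have h1 : E (α ++ [k]) (α ++ [k]) = E (α ++ [k]) (α ++ [k]) * E α α := by
      rw [← h.sum_eq α α rfl, Finset.mul_sum, Finset.sum_eq_single k]
      · rw [h.mul_self]
      · intro j _ hj
        refine h.mul_eq_zero _ _ _ _ (fun hp => hj ?_) fun hp => hj ?_
        · simpa using (hp.eq_of_length (by simp)).symm
        · simpa using hp.eq_of_length (by simp)
      · simp
    have h2 := ih (α := α ++ [k]) (h1 ▸ I.mul_mem_left _ _ hα)
    simpa using h2

/-- Positivity of J^K puts an extension ακ of α at every node of row `wordWeight L α + K`. Every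
other word δ of that node has the same weight, so E δ δ factors through E (ακ) (ακ), and the row
sums to 1. -/
lemma one_mem_of_E_mem (h : IsWordUnits L E) (hd : 0 < d) (hpos : ∀ i, 0 < L i)
    (hgcd : Finset.univ.gcd L = 1) (I : TwoSidedIdeal C) {α : List (Fin d)} (hα : E α α ∈ I) :
    (1 : C) ∈ I := by
  obtain ⟨K, hK⟩ := exists_incidenceMatrix_pow_pos hd hpos hgcd
  rw [← h.rowSum_eq_one hd hpos (wordWeight L α + K), rowSum]
  refine sum_mem fun m _ => sum_mem fun δ hδ => ?_
  have hne : 0 < (blockWords L K m).card := by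
    rw [card_blockWords hd hpos, nodeDim_eq_pow_apply (maxWeight_pos hd hpos)]
    exact hK K le_rfl _ _
  obtain ⟨κ, hκ⟩ := Finset.card_pos.1 hne
  have h1 := ((mem_blockWords hpos).1 hκ).1
  have h2 := ((mem_blockWords hpos).1 hδ).1
  have hw : wordWeight L δ = wordWeight L (α ++ κ) := by
    rw [wordWeight_append]
    omega
  rw [← h.mul_eq δ (α ++ κ) δ hw hw.symm, ← h.mul_eq δ (α ++ κ) (α ++ κ) hw rfl]
  exact I.mul_mem_right _ _ (I.mul_mem_left _ _ (h.E_append_mem I hα κ))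

/-- Approximate a nonzero y = x* x in the ideal by b* b with b in some row, and compress to a
minimal projection on which b* b attains its norm. The compressed y is then within distance 1 of
that projection. -/
lemma isSimple (h : IsWordUnits L E) (hd : 0 < d) (hpos : ∀ i, 0 < L i)
    (hgcd : Finset.univ.gcd L = 1) : IsSimpleCStarAlgebra C := by
  have _ := h.nontrivial
  refine ⟨h.nontrivial, fun I _ => ?_⟩
  by_cases hI : ∀ x ∈ I, x = 0
  · left
    exact le_antisymm (fun x hx => (TwoSidedIdeal.mem_bot C).2 (hI x hx)) bot_le
  · right
    push Not at hI
    obtain ⟨x, hx, hx0⟩ := hI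
    set y := star x * x with hy
    have hyI : y ∈ I := I.mul_mem_left _ _ hx
    have hy0 : 0 < ‖y‖ := by
      rw [hy, CStarRing.norm_star_mul_self]
      have := norm_pos_iff.2 hx0
      positivity
    obtain ⟨b, hb, hbU⟩ := (h.dense_iUnion_range_rowHom hd hpos).exists_mem_open
      -- Half of ‖y‖ makes the error smaller than r = ‖b* b‖ itself, since then r > ‖y‖ / 2.
      (U := {b : C | ‖star b * b - y‖ < ‖y‖ / 2})
      (isOpen_lt (by fun_prop) continuous_const) ⟨x, by simpa [← hy] using hy0⟩
    rw [Set.mem_iUnion] at hb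
    obtain ⟨n, M, rfl⟩ := hb
    have hU := h.isMatrixUnits hd hpos n
    obtain ⟨v, a, u, N, hN, hu, hbu⟩ := hU.exists_star_mul_mul_eq M
    set b : C := hU.hom M
    set e : C := E (blockEquiv hd hpos n v a) (blockEquiv hd hpos n v a)
    set r : ℝ := ‖star b * b‖
    have hbU : ‖star b * b - y‖ < ‖y‖ / 2 := hbU
    have hr : ‖y‖ / 2 < r := by
      have := norm_sub_norm_le y (star b * b)
      rw [norm_sub_rev] at this
      linarith
    have hr0 : 0 < r := by linarith
    have hun : ‖star u‖ * ‖u‖ ≤ N := by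
      rw [norm_star, ← CStarRing.norm_star_mul_self, hu, norm_smul, Complex.norm_real,
        Real.norm_of_nonneg hN.le]
      exact mul_le_of_le_one_right hN.le (hU.norm_le_one v a)
    -- Scaling by c⁻¹ turns u* (b* b) u into exactly e.
    set c : ℂ := ((r * N : ℝ) : ℂ) with hc
    have hc0 : c ≠ 0 := Complex.ofReal_ne_zero.2 (mul_pos hr0 hN).ne'
    have hmem : c⁻¹ • (star u * y * u) ∈ I := by
      rw [← one_mul (star u * y * u), ← smul_mul_assoc]
      exact I.mul_mem_left _ _ (I.mul_mem_right _ _ (I.mul_mem_left _ _ hyI))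
    have he : e ∈ I := by
      refine I.mem_of_norm_sub_lt_one (h.mul_self _) (hU.norm_le_one v a) hmem ?_
      have h1 : e - c⁻¹ • (star u * y * u) = c⁻¹ • (star u * (star b * b - y) * u) := by
        rw [mul_sub, sub_mul, hbu, smul_sub, smul_smul, inv_mul_cancel₀ hc0, one_smul]
      rw [h1, norm_smul, norm_inv, hc, Complex.norm_real, Real.norm_of_nonneg (by positivity),
        inv_mul_lt_iff₀ (by positivity), mul_one]
      calc ‖star u * (star b * b - y) * u‖ ≤ ‖star u‖ * ‖star b * b - y‖ * ‖u‖ := norm_mul₃_le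
        _ = ‖star b * b - y‖ * (‖star u‖ * ‖u‖) := by ring
        _ ≤ ‖star b * b - y‖ * N := by gcongr
        _ < r * N := by
          refine mul_lt_mul_of_pos_right ?_ hN
          linarith
    exact TwoSidedIdeal.one_mem_iff I |>.1 (h.one_mem_of_E_mem hd hpos hgcd I he)

/-! ### Trace states -/

lemma not_prefix_of_wordWeight_eq (hpos : ∀ i, 0 < L i) {α γ : List (Fin d)} (hne : α ≠ γ)
    (hw : wordWeight L α = wordWeight L γ) : ¬ α <+: γ := fun hp =>
  hne (eq_of_prefix_of_mem_blockWords hpos (mem_blockWords_zero hpos α)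
    (hw ▸ mem_blockWords_zero hpos γ) hp)

/-- Distinct words of equal weight are prefix-incomparable, so E α γ = E α α * E α γ has vanishing
product in the reverse order. -/
lemma trace_E_of_ne (h : IsWordUnits L E) (hpos : ∀ i, 0 < L i) {τ : C →ₗ[ℂ] ℂ}
    (hτ : IsTraceState τ) {α γ : List (Fin d)} (hne : α ≠ γ)
    (hw : wordWeight L α = wordWeight L γ) : τ (E α γ) = 0 := by
  rw [← h.mul_eq α α γ rfl hw, hτ.2, h.mul_eq_zero _ _ _ _
    (not_prefix_of_wordWeight_eq hpos hne.symm hw.symm)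
    (not_prefix_of_wordWeight_eq hpos hne hw), map_zero]

lemma trace_E_congr (h : IsWordUnits L E) {τ : C →ₗ[ℂ] ℂ} (hτ : IsTraceState τ)
    {α γ : List (Fin d)} (hw : wordWeight L α = wordWeight L γ) : τ (E α α) = τ (E γ γ) := by
  rw [← h.mul_eq α γ α hw hw.symm, hτ.2, h.mul_eq γ α γ hw.symm hw]

lemma trace_E_nonneg (h : IsWordUnits L E) {τ : C →ₗ[ℂ] ℂ} (hτ : IsTraceState τ)
    (α : List (Fin d)) : 0 ≤ τ (E α α) := by
  have := hτ.1.1 (E α α)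
  rwa [h.star_eq, h.mul_self] at this

/-- The values of a trace state on the matrix units. -/
lemma trace_E_self (h : IsWordUnits L E) (hpos : ∀ i, 0 < L i) (hgcd : Finset.univ.gcd L = 1)
    {β : ℝ} (hβ : ∑ i, Real.exp (-β * L i) = 1) {τ : C →ₗ[ℂ] ℂ} (hτ : IsTraceState τ)
    (α : List (Fin d)) : τ (E α α) = (Real.exp (-β * wordWeight L α) : ℝ) := by
  classical
  -- The trace value as a function of the weight; the choice of word is immaterial. The default 0 at
  -- integers that are not weights is harmless, as harmonicity is only tested at weights of words.
  set t : ℕ → ℝ := fun n =>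
    if hn : ∃ α : List (Fin d), wordWeight L α = n then (τ (E hn.choose hn.choose)).re else 0
    with ht
  have htα (α : List (Fin d)) : τ (E α α) = (t (wordWeight L α) : ℝ) := by
    have hn : ∃ γ : List (Fin d), wordWeight L γ = wordWeight L α := ⟨α, rfl⟩
    simp only [ht, dif_pos hn]
    rw [h.trace_E_congr hτ hn.choose_spec.symm]
    exact Complex.ext rfl (Complex.nonneg_iff.1 (h.trace_E_nonneg hτ _)).2.symm
  -- The factor e^{βn} turns the relation t(n) = ∑ t(n + L_k) into an average with the probabilities
  -- p_k.
  have hf : IsNonnegHarmonic L (fun k => Real.exp (-β * L k))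
      fun n => t n * Real.exp (β * n) := by
    refine ⟨fun α => ?_, fun α => ?_⟩
    · have := h.trace_E_nonneg hτ α
      rw [htα, Complex.zero_le_real] at this
      positivity
    · have h1 : t (wordWeight L α) = ∑ k, t (wordWeight L α + L k) := by
        have h2 := congrArg τ (h.sum_eq α α rfl)
        rw [map_sum] at h2
        simp only [htα, wordWeight_append, wordWeight_cons, wordWeight_nil, add_zero] at h2
        exact_mod_cast h2.symm
      rw [h1, Finset.sum_mul]
      refine Finset.sum_congr rfl fun k _ => ?_
      rw [mul_left_comm, ← Real.exp_add]
      congr 2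
      push_cast
      ring
  have h1 := hf.eq_apply_zero (fun k => Real.exp_pos _) hβ hpos hgcd α
  have h0 : t 0 = 1 := by
    have := htα []
    rw [h.nil_eq_one, hτ.1.2, wordWeight_nil] at this
    exact_mod_cast this.symm
  simp only [h0, Nat.cast_zero, mul_zero, Real.exp_zero, mul_one] at h1
  rw [htα, Complex.ofReal_inj, neg_mul, Real.exp_neg]
  exact eq_inv_of_mul_eq_one_left h1

/-- The functional with these values on the matrix units is tracial. -/
lemma map_mul_comm_of_map_E (h : IsWordUnits L E) (hd : 0 < d) (hpos : ∀ i, 0 < L i)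
    {φ : C →ₗ[ℂ] ℂ} (hφ : Continuous φ) {t : ℕ → ℂ}
    (hφE : ∀ α γ, wordWeight L α = wordWeight L γ →
      φ (E α γ) = if α = γ then t (wordWeight L α) else 0) (x y : C) :
    φ (x * y) = φ (y * x) := by
  -- On a row the functional is a weighted sum of matrix traces, because t depends only on the
  -- weight n + v of the node.
  have hrow (n : ℕ) (M : (fixedPointDiagram L).RowAlgebra n) :
      φ (h.rowHom hd hpos n M) = ∑ v, t (n + v.1) * (M v).trace := by
    rw [rowHom_apply, map_sum]
    refine Finset.sum_congr rfl fun v _ => ?_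
    rw [map_sum, Matrix.trace, Finset.mul_sum]
    refine Finset.sum_congr rfl fun a _ => ?_
    have hw (a) : wordWeight L (blockEquiv hd hpos n v a) = n + v.1.val :=
      ((mem_blockWords hpos).1 (blockEquiv hd hpos n v a).2).1
    rw [map_sum, Finset.sum_eq_single a]
    · rw [map_smul, hφE _ _ rfl, if_pos rfl, hw, smul_eq_mul, mul_comm, Matrix.diag_apply]
    · intro b _ hb
      rw [map_smul, hφE _ _ ((hw a).trans (hw b).symm), if_neg, smul_zero]
      exact fun h' => hb ((blockEquiv hd hpos n v).injective (Subtype.ext h')).symm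
    · simp
  have hdense := h.dense_iUnion_range_rowHom hd hpos
  have hmono : Monotone fun n => (h.rowHom hd hpos n).range :=
    monotone_nat_of_le_succ fun n => h.range_rowHom_le hd hpos n
  have key : ∀ x ∈ ⋃ n, ((h.rowHom hd hpos n).range : Set C),
      ∀ y ∈ ⋃ n, ((h.rowHom hd hpos n).range : Set C), φ (x * y) = φ (y * x) := by
    intro x hx y hy
    obtain ⟨i, hi⟩ := Set.mem_iUnion.1 hx
    obtain ⟨j, hj⟩ := Set.mem_iUnion.1 hy
    obtain ⟨M, rfl⟩ := hmono (le_max_left i j) hi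
    obtain ⟨N, rfl⟩ := hmono (le_max_right i j) hj
    change φ (h.rowHom hd hpos _ M * h.rowHom hd hpos _ N) =
      φ (h.rowHom hd hpos _ N * h.rowHom hd hpos _ M)
    rw [← map_mul, ← map_mul, hrow, hrow]
    exact Finset.sum_congr rfl fun v _ => by
      rw [Pi.mul_apply, Pi.mul_apply, Matrix.trace_mul_comm]
  have key' (x : C) : ∀ y ∈ ⋃ n, ((h.rowHom hd hpos n).range : Set C), φ (x * y) = φ (y * x) := by
    intro y hy
    exact congrFun (Continuous.ext_on hdense (f := fun x => φ (x * y)) (g := fun x => φ (y * x))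
      (by fun_prop) (by fun_prop) fun x hx => key x hx y hy) x
  exact congrFun (Continuous.ext_on hdense (f := fun y => φ (x * y)) (g := fun y => φ (y * x))
    (by fun_prop) (by fun_prop) (key' x)) y

lemma trace_eq (h : IsWordUnits L E) (hpos : ∀ i, 0 < L i) (hgcd : Finset.univ.gcd L = 1)
    {β : ℝ} (hβ : ∑ i, Real.exp (-β * L i) = 1) {τ φ : C →ₗ[ℂ] ℂ} (hτ : IsTraceState τ)
    (hφ : Continuous φ) (hφE : ∀ α γ, wordWeight L α = wordWeight L γ →
      φ (E α γ) = if α = γ then ((Real.exp (-β * wordWeight L α) : ℝ) : ℂ) else 0) : τ = φ := by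
  refine LinearMap.ext_of_dense_span hτ.1.continuous hφ h.dense ?_
  rintro _ ⟨α, γ, hw, rfl⟩
  rw [hφE α γ hw]
  split_ifs with hαγ
  · subst hαγ
    exact h.trace_E_self hpos hgcd hβ hτ α
  · exact h.trace_E_of_ne hpos hτ hαγ hw

end IsWordUnits

/-! ### A realization of the Cuntz relations on `ℓ²(ℕ)` -/

namespace CuntzRealization

/-- The Hilbert space `ℓ²(ℕ)`. -/
abbrev SequenceSpace : Type := lp (fun _ : ℕ => ℂ) 2

instance : Nontrivial SequenceSpace :=
  ⟨lp.single 2 0 1, 0, fun h => by simpa using congrArg (fun f : SequenceSpace => f 0) h⟩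

lemma two_toReal_pos : (0 : ℝ) < (2 : ℝ≥0∞).toReal := by norm_num

/-- Extension by zero only inserts zero terms, so `push` is well defined and preserves the norm. -/
lemma hasSum_extend {e : ℕ → ℕ} (he : Function.Injective e) (f : SequenceSpace) :
    HasSum (fun k => ‖Function.extend e (f : ℕ → ℂ) 0 k‖ ^ (2 : ℝ≥0∞).toReal)
      (‖f‖ ^ (2 : ℝ≥0∞).toReal) := by
  refine (he.hasSum_iff fun k hk => ?_).1 ?_
  · rw [Function.extend_apply' _ _ _ fun h => hk h]
    simp
  · refine (lp.hasSum_norm two_toReal_pos f).congr_fun ?_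
    intro n
    simp [he.extend_apply]

/-- The isometry `δ_n ↦ δ_{e n}` for an injective map `e`. -/
noncomputable def push {e : ℕ → ℕ} (he : Function.Injective e) :
    SequenceSpace →L[ℂ] SequenceSpace :=
  LinearMap.mkContinuous
    { toFun := fun f => ⟨Function.extend e f 0,
        (memℓp_gen_iff two_toReal_pos).2 (hasSum_extend he f).summable⟩
      map_add' := fun f g => by
        apply lp.ext
        funext k
        change Function.extend e (f + g : ℕ → ℂ) 0 k =
          Function.extend e f 0 k + Function.extend e g 0 k
        by_cases h : ∃ n, e n = k
        · obtain ⟨n, rfl⟩ := h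
          simp [he.extend_apply]
        · simp [Function.extend_apply' _ _ _ h]
      map_smul' := fun c f => by
        apply lp.ext
        funext k
        change Function.extend e (c • f : ℕ → ℂ) 0 k = c • Function.extend e f 0 k
        by_cases h : ∃ n, e n = k
        · obtain ⟨n, rfl⟩ := h
          simp [he.extend_apply]
        · simp [Function.extend_apply' _ _ _ h] } 1
    fun f => by
      rw [one_mul]
      exact lp.norm_le_of_tsum_le two_toReal_pos (norm_nonneg f) (hasSum_extend he f).tsum_eq.le

lemma push_apply {e : ℕ → ℕ} (he : Function.Injective e) (f : SequenceSpace) (k : ℕ) :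
    push he f k = Function.extend e (f : ℕ → ℂ) 0 k := rfl

lemma summable_comp {e : ℕ → ℕ} (he : Function.Injective e) (f : SequenceSpace) :
    Summable fun n => ‖f (e n)‖ ^ (2 : ℝ≥0∞).toReal :=
  (lp.hasSum_norm two_toReal_pos f).summable.comp_injective he

/-- The adjoint of `push`. -/
noncomputable def pull {e : ℕ → ℕ} (he : Function.Injective e) :
    SequenceSpace →L[ℂ] SequenceSpace :=
  LinearMap.mkContinuous
    { toFun := fun f => ⟨fun n => f (e n), (memℓp_gen_iff two_toReal_pos).2 (summable_comp he f)⟩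
      map_add' := fun _ _ => rfl
      map_smul' := fun _ _ => rfl } 1
    fun f => by
      rw [one_mul]
      refine lp.norm_le_of_tsum_le two_toReal_pos (norm_nonneg f) ?_
      rw [lp.norm_rpow_eq_tsum two_toReal_pos]
      exact Summable.tsum_le_tsum_of_inj e he (fun _ _ => by positivity) (fun _ => le_rfl)
        (summable_comp he f) (lp.hasSum_norm two_toReal_pos f).summable

lemma pull_apply {e : ℕ → ℕ} (he : Function.Injective e) (f : SequenceSpace) (n : ℕ) :
    pull he f n = f (e n) := rfl

lemma star_push {e : ℕ → ℕ} (he : Function.Injective e) : star (push he) = pull he := by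
  rw [eq_comm, ContinuousLinearMap.star_eq_adjoint, ContinuousLinearMap.eq_adjoint_iff]
  intro f g
  refine HasSum.unique (lp.hasSum_inner (𝕜 := ℂ) (pull he f) g) ?_
  have h := lp.hasSum_inner (𝕜 := ℂ) f (push he g)
  refine ((he.hasSum_iff fun k hk => ?_).2 h).congr_fun fun n => ?_
  · rw [push_apply, Function.extend_apply' _ _ _ fun h => hk h]
    simp
  · simp [push_apply, pull_apply, he.extend_apply]

lemma injective_mul_add {d : ℕ} (hd : 0 < d) (i : Fin d) :
    Function.Injective fun n => d * n + i.val := fun a b h => by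
  simpa [hd.ne'] using h

/-- The realization `s_i δ_n = δ_{d n + i}`. -/
noncomputable def family {d : ℕ} (hd : 0 < d) : CuntzFamily d where
  carrier := SequenceSpace →L[ℂ] SequenceSpace
  s i := push (injective_mul_add hd i)
  star_mul i j := by
    rw [star_push]
    ext f : 1
    apply lp.ext
    funext n
    change Function.extend (fun n => d * n + j.val) (f : ℕ → ℂ) 0 (d * n + i.val) = _
    split_ifs with h
    · subst h
      exact (injective_mul_add hd i).extend_apply _ _ _
    · rw [Function.extend_apply']
      · rfl
      · rintro ⟨m, hm⟩
        apply h
        -- The ranges of n ↦ dn + i are the residue classes mod d: disjointness gives the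
        -- orthogonality relation, and covering ℕ gives the sum relation.
        have h1 := congrArg (· % d) hm
        simp only [Nat.mul_add_mod, Nat.mod_eq_of_lt i.2, Nat.mod_eq_of_lt j.2] at h1
        exact Fin.ext h1.symm
  sum_mul_star := by
    ext f : 1
    apply lp.ext
    funext k
    rw [sum_apply, lp.coeFn_sum, Finset.sum_apply,
      Finset.sum_eq_single (⟨k % d, Nat.mod_lt k hd⟩ : Fin d)]
    · rw [star_push]
      have h1 := (injective_mul_add hd ⟨k % d, Nat.mod_lt k hd⟩).extend_apply
        (fun n => f (d * n + k % d)) 0 (k / d)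
      simp only [Nat.div_add_mod] at h1
      exact h1
    · intro i _ hi
      rw [star_push]
      change Function.extend (fun n => d * n + i.val) (fun n => f (d * n + i.val)) 0 k = 0
      rw [Function.extend_apply']
      · rfl
      · rintro ⟨m, hm⟩
        apply hi
        ext
        simp only [← hm, Nat.mul_add_mod, Nat.mod_eq_of_lt i.2]
    · simp

end CuntzRealization

/-! ### Words in a family of isometries satisfying the Cuntz relations -/

/-- The Cuntz relations. -/
structure IsCuntz {A : Type*} [CStarAlgebra A] {d : ℕ} (s : Fin d → A) : Prop where
  star_mul : ∀ i j, star (s i) * s j = if i = j then 1 else 0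
  sum_mul_star : ∑ i, s i * star (s i) = 1

/-- The monomial `s_α`. -/
def monomial {A : Type*} [CStarAlgebra A] {d : ℕ} (s : Fin d → A) (α : List (Fin d)) : A :=
  (α.map s).prod

namespace IsCuntz

variable {A : Type*} [CStarAlgebra A] {d : ℕ} {s : Fin d → A}

@[simp] lemma monomial_nil : monomial s [] = 1 := rfl

lemma monomial_cons (k : Fin d) (α : List (Fin d)) :
    monomial s (k :: α) = s k * monomial s α := by simp [monomial]

lemma monomial_append (α γ : List (Fin d)) :
    monomial s (α ++ γ) = monomial s α * monomial s γ := by simp [monomial]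

lemma star_monomial_mul_self (hs : IsCuntz s) (α : List (Fin d)) :
    star (monomial s α) * monomial s α = 1 := by
  induction α with
  | nil => simp
  | cons k α ih =>
    rw [monomial_cons, StarMul.star_mul, mul_assoc, ← mul_assoc (star (s k)), hs.star_mul,
      if_pos rfl, one_mul, ih]

lemma star_monomial_mul_append (hs : IsCuntz s) (α γ : List (Fin d)) :
    star (monomial s α) * monomial s (α ++ γ) = monomial s γ := by
  rw [monomial_append, ← mul_assoc, hs.star_monomial_mul_self, one_mul]

lemma star_monomial_mul_eq_zero (hs : IsCuntz s) {α γ : List (Fin d)} (h₁ : ¬ α <+: γ)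
    (h₂ : ¬ γ <+: α) : star (monomial s α) * monomial s γ = 0 := by
  induction α generalizing γ with
  | nil => simp at h₁
  | cons k α ih =>
    cases γ with
    | nil => simp at h₂
    | cons j γ =>
      rw [monomial_cons, monomial_cons, StarMul.star_mul, mul_assoc, ← mul_assoc (star (s k)),
        hs.star_mul]
      split_ifs with hkj
      · subst hkj
        rw [one_mul, ih (by simpa using h₁) (by simpa using h₂)]
      · simp

lemma norm_s_le (hs : IsCuntz s) (i : Fin d) : ‖s i‖ ≤ 1 := by
  nontriviality A
  have h2 := CStarRing.norm_star_mul_self (x := s i)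
  rw [hs.star_mul, if_pos rfl, CStarRing.norm_one] at h2
  nlinarith [norm_nonneg (s i)]

lemma norm_monomial_le (hs : IsCuntz s) (α : List (Fin d)) : ‖monomial s α‖ ≤ 1 := by
  nontriviality A
  have h2 := CStarRing.norm_star_mul_self (x := monomial s α)
  rw [hs.star_monomial_mul_self, CStarRing.norm_one] at h2
  nlinarith [norm_nonneg (monomial s α)]

/-- The set of all `s_α s_γ*`. -/
def monomials (s : Fin d → A) : Set A :=
  {x | ∃ α γ, monomial s α * star (monomial s γ) = x}

/-- The middle factor s_γ* s_μ either cancels to a word or to the adjoint of a word, or vanishes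
when γ and μ are incomparable. -/
lemma mul_mem_span (hs : IsCuntz s) {x y : A} (hx : x ∈ Submodule.span ℂ (monomials s))
    (hy : y ∈ Submodule.span ℂ (monomials s)) : x * y ∈ Submodule.span ℂ (monomials s) := by
  refine (Submodule.span_mul_span ℂ (monomials s) (monomials s)).trans_le ?_
    (Submodule.mul_mem_mul hx hy)
  rw [Submodule.span_le]
  rintro _ ⟨_, ⟨α, γ, rfl⟩, _, ⟨μ, ν, rfl⟩, rfl⟩
  change monomial s α * star (monomial s γ) * (monomial s μ * star (monomial s ν)) ∈ _
  rw [mul_assoc, ← mul_assoc (star _)]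
  by_cases h₁ : γ <+: μ
  · obtain ⟨ε, rfl⟩ := h₁
    rw [hs.star_monomial_mul_append, ← mul_assoc, ← monomial_append]
    exact Submodule.subset_span ⟨_, _, rfl⟩
  by_cases h₂ : μ <+: γ
  · obtain ⟨ε, rfl⟩ := h₂
    have : star (monomial s (μ ++ ε)) * monomial s μ = star (monomial s ε) := by
      rw [← hs.star_monomial_mul_append μ ε, StarMul.star_mul, star_star]
    rw [this, ← StarMul.star_mul, ← monomial_append]
    exact Submodule.subset_span ⟨_, _, rfl⟩
  · rw [hs.star_monomial_mul_eq_zero h₁ h₂, zero_mul, mul_zero]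
    exact zero_mem _

lemma star_mem_span {x : A} (hx : x ∈ Submodule.span ℂ (monomials s)) :
    star x ∈ Submodule.span ℂ (monomials s) := by
  induction hx using Submodule.span_induction with
  | mem x h =>
    obtain ⟨α, γ, rfl⟩ := h
    rw [StarMul.star_mul, star_star]
    exact Submodule.subset_span ⟨_, _, rfl⟩
  | zero => simp
  | add x y _ _ hx hy => rw [star_add]; exact add_mem hx hy
  | smul c x _ hx => rw [star_smul]; exact Submodule.smul_mem _ _ hx

lemma mem_span_of_mem_adjoin (hs : IsCuntz s) {x : A}
    (hx : x ∈ StarAlgebra.adjoin ℂ (Set.range s)) : x ∈ Submodule.span ℂ (monomials s) := by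
  induction hx using StarAlgebra.adjoin_induction with
  | mem x h =>
    obtain ⟨i, rfl⟩ := h
    exact Submodule.subset_span ⟨[i], [], by simp [monomial]⟩
  | algebraMap r =>
    rw [Algebra.algebraMap_eq_smul_one]
    exact Submodule.smul_mem _ _ (Submodule.subset_span ⟨[], [], by simp⟩)
  | add x y _ _ hx hy => exact add_mem hx hy
  | mul x y _ _ hx hy => exact hs.mul_mem_span hx hy
  | star x _ hx => exact star_mem_span hx

end IsCuntz

/-! ### The quasi-free state -/

namespace IsCuntz

variable {A : Type*} [CStarAlgebra A] {d : ℕ} {s : Fin d → A} {p : Fin d → ℝ}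

/-- The unital completely positive map `x ↦ ∑ᵢ pᵢ sᵢ* x sᵢ`. -/
noncomputable def transfer (s : Fin d → A) (p : Fin d → ℝ) : Module.End ℂ A where
  toFun x := ∑ i, (p i : ℂ) • (star (s i) * x * s i)
  map_add' x y := by simp only [mul_add, add_mul, smul_add, Finset.sum_add_distrib]
  map_smul' c x := by
    simp only [mul_smul_comm, smul_mul_assoc, Finset.smul_sum, RingHom.id_apply]
    exact Finset.sum_congr rfl fun i _ => smul_comm _ _ _

lemma transfer_apply (x : A) :
    transfer s p x = ∑ i, (p i : ℂ) • (star (s i) * x * s i) := rfl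

lemma transfer_pow_succ (n : ℕ) (x : A) :
    (transfer s p ^ (n + 1)) x = (transfer s p ^ n) (transfer s p x) := by
  rw [pow_succ, Module.End.mul_apply]

lemma norm_transfer_le (hs : IsCuntz s) (hp : ∀ k, 0 ≤ p k) (hsum : ∑ k, p k = 1) (x : A) :
    ‖transfer s p x‖ ≤ ‖x‖ := by
  calc ‖transfer s p x‖ ≤ ∑ i, ‖(p i : ℂ) • (star (s i) * x * s i)‖ :=
        by rw [transfer_apply]; exact norm_sum_le _ _
    _ ≤ ∑ i, p i * ‖x‖ := by
      refine Finset.sum_le_sum fun i _ => ?_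
      rw [norm_smul, Complex.norm_real, Real.norm_of_nonneg (hp i)]
      refine mul_le_mul_of_nonneg_left ?_ (hp i)
      have h1 := hs.norm_s_le i
      calc ‖star (s i) * x * s i‖ ≤ ‖star (s i)‖ * ‖x‖ * ‖s i‖ := norm_mul₃_le
        _ ≤ 1 * ‖x‖ * 1 := by
          rw [norm_star]
          gcongr
        _ = ‖x‖ := by ring
    _ = ‖x‖ := by rw [← Finset.sum_mul, hsum, one_mul]

lemma norm_transfer_pow_le (hs : IsCuntz s) (hp : ∀ k, 0 ≤ p k) (hsum : ∑ k, p k = 1) (n : ℕ)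
    (x : A) : ‖(transfer s p ^ n) x‖ ≤ ‖x‖ := by
  induction n generalizing x with
  | zero => simp
  | succ n ih =>
    rw [transfer_pow_succ]
    exact (ih _).trans (hs.norm_transfer_le hp hsum x)

lemma transfer_star (x : A) : transfer s p (star x) = star (transfer s p x) := by
  simp only [transfer_apply, star_sum, star_smul, StarMul.star_mul, star_star, mul_assoc,
    Complex.star_def, Complex.conj_ofReal]

lemma transfer_pow_star (n : ℕ) (x : A) :
    (transfer s p ^ n) (star x) = star ((transfer s p ^ n) x) := by
  induction n generalizing x with
  | zero => simp
  | succ n ih => rw [transfer_pow_succ, transfer_pow_succ, transfer_star, ih]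

lemma transfer_pow_one (hs : IsCuntz s) (hsum : ∑ k, p k = 1) (n : ℕ) :
    (transfer s p ^ n) (1 : A) = 1 := by
  induction n with
  | zero => simp
  | succ n ih =>
    have : transfer s p (1 : A) = 1 := by
      simp only [transfer_apply, mul_one, hs.star_mul, if_true]
      rw [← Finset.sum_smul, ← Complex.ofReal_sum, hsum, Complex.ofReal_one, one_smul]
    rw [transfer_pow_succ, this, ih]

lemma transfer_cons_cons (hs : IsCuntz s) (i j : Fin d) (α γ : List (Fin d)) :
    transfer s p (monomial s (i :: α) * star (monomial s (j :: γ))) =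
      if i = j then (p i : ℂ) • (monomial s α * star (monomial s γ)) else 0 := by
  have h (k : Fin d) : star (s k) * (monomial s (i :: α) * star (monomial s (j :: γ))) * s k =
      (star (s k) * s i) * (monomial s α * star (monomial s γ)) * (star (s j) * s k) := by
    simp only [monomial_cons, StarMul.star_mul, mul_assoc]
  simp only [transfer_apply, h]
  rw [Finset.sum_eq_single i]
  · rw [hs.star_mul, hs.star_mul, if_pos rfl, one_mul]
    by_cases hij : i = j
    · simp [hij]
    · simp [hij, Ne.symm hij]
  · intro k _ hk
    rw [hs.star_mul, if_neg hk, zero_mul, zero_mul, smul_zero]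
  · simp

/-- Against no starred letter the map rotates the word and contributes a factor p_i. The length
never drops, so iteration gives geometric decay. -/
lemma transfer_cons (hs : IsCuntz s) (i : Fin d) (α : List (Fin d)) :
    transfer s p (monomial s (i :: α)) = (p i : ℂ) • monomial s (α ++ [i]) := by
  rw [transfer_apply, Finset.sum_eq_single i]
  · rw [monomial_cons, ← mul_assoc, hs.star_mul, if_pos rfl, one_mul, monomial_append]
    simp [monomial]
  · intro k _ hk
    rw [monomial_cons, ← mul_assoc, hs.star_mul, if_neg hk, zero_mul, zero_mul, smul_zero]
  · simp

lemma norm_transfer_pow_monomial_le (hs : IsCuntz s) (hp : ∀ k, 0 ≤ p k) {q : ℝ}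
    (hq : ∀ k, p k ≤ q) (n : ℕ) {α : List (Fin d)} (hα : α ≠ []) :
    ‖(transfer s p ^ n) (monomial s α)‖ ≤ q ^ n := by
  induction n generalizing α with
  | zero => simpa using hs.norm_monomial_le α
  | succ n ih =>
    obtain ⟨i, γ, rfl⟩ := List.exists_cons_of_ne_nil hα
    rw [transfer_pow_succ, hs.transfer_cons, map_smul, norm_smul, Complex.norm_real,
      Real.norm_of_nonneg (hp i), pow_succ']
    exact mul_le_mul (hq i) (ih (by simp)) (norm_nonneg _) ((hp i).trans (hq i))

open Filter Topology in
lemma tendsto_transfer_pow_monomial (hs : IsCuntz s) (hp : ∀ k, 0 ≤ p k) {q : ℝ}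
    (hq : ∀ k, p k ≤ q) (hq1 : q < 1) {α : List (Fin d)} (hα : α ≠ []) :
    Tendsto (fun n => (transfer s p ^ n) (monomial s α)) atTop (𝓝 0) := by
  obtain ⟨i, -⟩ := List.exists_cons_of_ne_nil hα
  exact squeeze_zero_norm (fun n => hs.norm_transfer_pow_monomial_le hp hq n hα)
    (tendsto_pow_atTop_nhds_zero_of_lt_one ((hp i).trans (hq i)) hq1)

open Filter Topology in
-- Equal first letters are stripped with a factor p_i and unequal ones give 0. What remains is 1, or
-- a one-sided nonempty word, which decays to 0.
lemma tendsto_transfer_pow (hs : IsCuntz s) (hp : ∀ k, 0 ≤ p k) (hsum : ∑ k, p k = 1) {q : ℝ}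
    (hq : ∀ k, p k ≤ q) (hq1 : q < 1) (α γ : List (Fin d)) :
    Tendsto (fun n => (transfer s p ^ n) (monomial s α * star (monomial s γ))) atTop
      (𝓝 ((if α = γ then (((α.map p).prod : ℝ) : ℂ) else 0) • (1 : A))) := by
  induction α generalizing γ with
  | nil =>
    cases γ with
    | nil => simp [hs.transfer_pow_one hsum]
    | cons j γ =>
      have := (hs.tendsto_transfer_pow_monomial hp hq hq1 (List.cons_ne_nil j γ)).star
      simpa [transfer_pow_star] using this
  | cons i α ih =>
    cases γ with
    | nil =>
      simpa using hs.tendsto_transfer_pow_monomial hp hq hq1 (List.cons_ne_nil i α)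
    | cons j γ =>
      rw [← tendsto_add_atTop_iff_nat 1]
      simp only [transfer_pow_succ, hs.transfer_cons_cons, List.cons.injEq]
      by_cases hij : i = j
      · subst hij
        simp only [if_true, true_and, map_smul, List.map_cons, List.prod_cons]
        convert (ih γ).const_smul (p i : ℂ) using 2
        rw [smul_smul]
        split_ifs <;> simp
      · simp [hij]

open Filter Topology in
-- The iterates are contractions, so being eventually close to a scalar passes from the dense span
-- to every x.
lemma exists_tendsto_transfer_pow (hs : IsCuntz s) (hp : ∀ k, 0 ≤ p k) (hsum : ∑ k, p k = 1)
    {q : ℝ} (hq : ∀ k, p k ≤ q) (hq1 : q < 1)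
    (hdense : Dense (Submodule.span ℂ (monomials s) : Set A)) (x : A) :
    ∃ c : ℂ, Tendsto (fun n => (transfer s p ^ n) x) atTop (𝓝 (c • (1 : A))) := by
  have hspan : ∀ y ∈ Submodule.span ℂ (monomials s),
      ∃ c : ℂ, Tendsto (fun n => (transfer s p ^ n) y) atTop (𝓝 (c • (1 : A))) := by
    intro y hy
    induction hy using Submodule.span_induction with
    | mem y h =>
      obtain ⟨α, γ, rfl⟩ := h
      exact ⟨_, hs.tendsto_transfer_pow hp hsum hq hq1 α γ⟩
    | zero => exact ⟨0, by simp⟩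
    | add y z _ _ hy hz =>
      obtain ⟨a, ha⟩ := hy
      obtain ⟨b, hb⟩ := hz
      exact ⟨a + b, by simpa [add_smul] using ha.add hb⟩
    | smul c y _ hy =>
      obtain ⟨a, ha⟩ := hy
      exact ⟨c * a, by simpa [smul_smul] using ha.const_smul c⟩
  have happrox : ∀ ε > 0, ∃ c : ℂ, ∀ᶠ n in atTop, ‖(transfer s p ^ n) x - c • (1 : A)‖ < ε := by
    intro ε hε
    obtain ⟨y, hy, hxy⟩ := Metric.dense_iff.1 hdense x (ε / 2) (by positivity)
    obtain ⟨c, hc⟩ := hspan y hxy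
    refine ⟨c, ?_⟩
    filter_upwards [Metric.tendsto_nhds.1 hc (ε / 2) (by positivity)] with n hn
    rw [dist_eq_norm] at hn
    rw [Metric.mem_ball, dist_eq_norm, norm_sub_rev] at hy
    calc ‖(transfer s p ^ n) x - c • (1 : A)‖
        = ‖(transfer s p ^ n) (x - y) + ((transfer s p ^ n) y - c • (1 : A))‖ := by
          rw [map_sub]; congr 1; abel
      _ ≤ ‖(transfer s p ^ n) (x - y)‖ + ‖(transfer s p ^ n) y - c • (1 : A)‖ := norm_add_le _ _
      _ < ε := by linarith [hs.norm_transfer_pow_le hp hsum n (x - y)]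
  have hcauchy : CauchySeq fun n => (transfer s p ^ n) x := by
    rw [Metric.cauchySeq_iff']
    intro ε hε
    obtain ⟨c, hc⟩ := happrox (ε / 2) (by positivity)
    obtain ⟨N, hN⟩ := eventually_atTop.1 hc
    refine ⟨N, fun n hn => ?_⟩
    have h1 := hN n hn
    have h2 := hN N le_rfl
    rw [← dist_eq_norm] at h1 h2
    linarith [dist_triangle_right ((transfer s p ^ n) x) ((transfer s p ^ N) x) (c • (1 : A))]
  obtain ⟨l, hl⟩ := cauchySeq_tendsto_of_complete hcauchy
  -- The scalars form a finite-dimensional, hence closed, subspace, so the limit of near-scalars is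
  -- scalar.
  have hmem : l ∈ (Submodule.span ℂ {(1 : A)} : Set A) := by
    rw [← (Submodule.closed_of_finiteDimensional (Submodule.span ℂ {(1 : A)})).closure_eq,
      Metric.mem_closure_iff]
    intro ε hε
    obtain ⟨c, hc⟩ := happrox (ε / 2) (by positivity)
    refine ⟨c • 1, Submodule.smul_mem _ _ (Submodule.mem_span_singleton_self _), ?_⟩
    have h1 : ‖l - c • (1 : A)‖ ≤ ε / 2 :=
      le_of_tendsto (hl.sub_const (c • (1 : A))).norm (hc.mono fun n hn => hn.le)
    rw [dist_eq_norm]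
    linarith
  obtain ⟨c, hc⟩ := Submodule.mem_span_singleton.1 hmem
  exact ⟨c, hc ▸ hl⟩

lemma transfer_pow_nonneg [PartialOrder A] [StarOrderedRing A] (hp : ∀ k, 0 ≤ p k) (n : ℕ)
    {x : A} (hx : 0 ≤ x) : 0 ≤ (transfer s p ^ n) x := by
  induction n generalizing x with
  | zero => simpa using hx
  | succ n ih =>
    rw [transfer_pow_succ]
    refine ih ?_
    rw [transfer_apply]
    refine Finset.sum_nonneg fun i _ => ?_
    rw [Complex.coe_smul]
    exact smul_nonneg (hp i) (star_left_conjugate_nonneg hx (s i))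

/-- The existence of the quasi-free state. -/
lemma exists_state [Nontrivial A] (hs : IsCuntz s) (hp : ∀ k, 0 ≤ p k) (hsum : ∑ k, p k = 1)
    {q : ℝ} (hq : ∀ k, p k ≤ q) (hq1 : q < 1)
    (hdense : Dense (Submodule.span ℂ (monomials s) : Set A)) :
    ∃ ω : A →ₗ[ℂ] ℂ, IsState ω ∧ ∀ α γ, ω (monomial s α * star (monomial s γ)) =
      if α = γ then (((α.map p).prod : ℝ) : ℂ) else 0 := by
  choose c hc using hs.exists_tendsto_transfer_pow hp hsum hq hq1 hdense
  have huniq {x : A} {a : ℂ}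
      (h : Filter.Tendsto (fun n => (transfer s p ^ n) x) Filter.atTop (nhds (a • (1 : A)))) :
      c x = a :=
    smul_left_injective ℂ (one_ne_zero (α := A)) (tendsto_nhds_unique (hc x) h)
  let ω : A →ₗ[ℂ] ℂ :=
    { toFun := c
      map_add' := fun x y => huniq (by simpa [add_smul] using (hc x).add (hc y))
      map_smul' := fun a x => huniq (by simpa [smul_smul] using (hc x).const_smul a) }
  refine ⟨ω, ⟨fun x => ?_, ?_⟩, fun α γ => huniq (hs.tendsto_transfer_pow hp hsum hq hq1 α γ)⟩
  · let _ : PartialOrder A := CStarAlgebra.spectralOrder A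
    have _ : StarOrderedRing A := CStarAlgebra.spectralOrderedRing A
    have h0 : 0 ≤ c (star x * x) • (1 : A) :=
      ge_of_tendsto' (hc (star x * x)) fun n =>
        transfer_pow_nonneg hp n (star_mul_self_nonneg x)
    -- The sign of the scalar is read off the spectrum of the positive element c • 1.
    refine spectrum_nonneg_of_nonneg h0 ?_
    rw [← Algebra.algebraMap_eq_smul_one, spectrum.scalar_eq]
    exact Set.mem_singleton _
  · exact huniq (by simp [hs.transfer_pow_one hsum])

/-! ### Averaging over the one-parameter group -/

/-- The set of all `s_α s_γ*` with `α`, `γ` of equal weight. -/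
def balancedMonomials (L : Fin d → ℕ) (s : Fin d → A) : Set A :=
  {x | ∃ α γ, wordWeight L α = wordWeight L γ ∧ monomial s α * star (monomial s γ) = x}

/-- The mean of a one-parameter family of maps over the `N`-th roots of unity. -/
noncomputable def rootMean (σ : ℝ → A →⋆ₐ[ℂ] A) (N : ℕ) (x : A) : A :=
  (N : ℂ)⁻¹ • ∑ j ∈ Finset.range N, σ (2 * Real.pi * j / N) x

lemma map_monomial {L : Fin d → ℕ} {σ : ℝ → A →⋆ₐ[ℂ] A}
    (hσ : ∀ t i, σ t (s i) = Complex.exp (Complex.I * t * L i) • s i) (t : ℝ)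
    (α : List (Fin d)) :
    σ t (monomial s α) = Complex.exp (Complex.I * t * wordWeight L α) • monomial s α := by
  induction α with
  | nil => simp
  | cons k α ih =>
    rw [monomial_cons, map_mul, hσ, ih, smul_mul_smul_comm, ← Complex.exp_add, wordWeight_cons]
    push_cast
    ring_nf

lemma map_monomial_mul_star {L : Fin d → ℕ} {σ : ℝ → A →⋆ₐ[ℂ] A}
    (hσ : ∀ t i, σ t (s i) = Complex.exp (Complex.I * t * L i) • s i) (t : ℝ)
    (α γ : List (Fin d)) :
    σ t (monomial s α * star (monomial s γ)) =
      Complex.exp (Complex.I * t * ((wordWeight L α : ℂ) - wordWeight L γ)) •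
        (monomial s α * star (monomial s γ)) := by
  rw [map_mul, map_star, map_monomial hσ, map_monomial hσ, star_smul, smul_mul_smul_comm,
    Complex.star_def, ← Complex.exp_conj, ← Complex.exp_add]
  congr 2
  simp only [map_mul, Complex.conj_I, Complex.conj_ofReal, Complex.conj_natCast]
  ring

/-- A geometric sum of an N-th root of unity, which differs from 1 because 0 < |k| < N. -/
lemma sum_exp_eq_zero {N : ℕ} {k : ℤ} (hk : k ≠ 0) (hN : k.natAbs < N) :
    ∑ j ∈ Finset.range N, Complex.exp (Complex.I * ((2 * Real.pi * j / N : ℝ) : ℂ) * k) = 0 := by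
  have hN0 : (N : ℂ) ≠ 0 := Nat.cast_ne_zero.2 (by omega)
  set z := Complex.exp (2 * Real.pi * Complex.I * (k / N)) with hz
  have h1 : ∀ j : ℕ, Complex.exp (Complex.I * ((2 * Real.pi * j / N : ℝ) : ℂ) * k) = z ^ j := by
    intro j
    rw [hz, ← Complex.exp_nat_mul]
    congr 1
    push_cast
    ring
  have hzN : z ^ N = 1 := by
    rw [hz, ← Complex.exp_nat_mul, Complex.exp_eq_one_iff]
    exact ⟨k, by field_simp⟩
  have hz1 : z ≠ 1 := by
    intro h
    rw [hz, Complex.exp_eq_one_iff] at h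
    obtain ⟨m, hm⟩ := h
    have hpi : (2 * Real.pi * Complex.I : ℂ) ≠ 0 := Complex.two_pi_I_ne_zero
    have h2 : (k / N : ℂ) = m := by
      apply mul_left_cancel₀ hpi
      rw [hm]
      ring
    rw [div_eq_iff hN0] at h2
    have h3 : k = m * N := by exact_mod_cast h2
    rcases eq_or_ne m 0 with rfl | hm0
    · simp at h3
      exact hk h3
    · have h4 : k.natAbs = m.natAbs * N := by rw [h3, Int.natAbs_mul, Int.natAbs_natCast]
      have h5 : 1 ≤ m.natAbs := Int.natAbs_pos.2 hm0
      nlinarith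
  simp only [h1]
  rw [geom_sum_eq hz1, hzN, sub_self, zero_div]

/-- A monomial with unequal weights is averaged to 0 once N exceeds the weight difference, and a
finite combination admits a common threshold. Finite means thus replace integration over the group.
-/
lemma exists_rootMean_mem_span {L : Fin d → ℕ} {σ : ℝ → A →⋆ₐ[ℂ] A}
    (hσ : ∀ t i, σ t (s i) = Complex.exp (Complex.I * t * L i) • s i) {y : A}
    (hy : y ∈ Submodule.span ℂ (monomials s)) :
    ∃ N₀, ∀ N ≥ N₀, rootMean σ N y ∈ Submodule.span ℂ (balancedMonomials L s) := by
  induction hy using Submodule.span_induction with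
  | mem y h =>
    obtain ⟨α, γ, rfl⟩ := h
    refine ⟨((wordWeight L α : ℤ) - wordWeight L γ).natAbs + 1, fun N hN => ?_⟩
    rw [rootMean]
    refine Submodule.smul_mem _ _ ?_
    by_cases hw : wordWeight L α = wordWeight L γ
    · refine Submodule.sum_mem _ fun j _ => ?_
      rw [map_monomial_mul_star hσ]
      exact Submodule.smul_mem _ _ (Submodule.subset_span ⟨α, γ, hw, rfl⟩)
    · simp only [map_monomial_mul_star hσ]
      rw [← Finset.sum_smul]
      have := sum_exp_eq_zero (N := N) (k := (wordWeight L α : ℤ) - wordWeight L γ) (by omega)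
        (by omega)
      push_cast at this ⊢
      rw [this, zero_smul]
      exact zero_mem _
  | zero => exact ⟨0, fun N _ => by simp [rootMean]⟩
  | add y z _ _ hy hz =>
    obtain ⟨a, ha⟩ := hy
    obtain ⟨b, hb⟩ := hz
    refine ⟨max a b, fun N hN => ?_⟩
    have : rootMean σ N (y + z) = rootMean σ N y + rootMean σ N z := by
      simp [rootMean, Finset.sum_add_distrib]
    rw [this]
    exact add_mem (ha N (le_of_max_le_left hN)) (hb N (le_of_max_le_right hN))
  | smul c y _ hy =>
    obtain ⟨a, ha⟩ := hy
    refine ⟨a, fun N hN => ?_⟩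
    have : rootMean σ N (c • y) = c • rootMean σ N y := by
      simp only [rootMean, map_smul, ← Finset.smul_sum]
      exact smul_comm _ _ _
    rw [this]
    exact Submodule.smul_mem _ _ (ha N hN)

/-- The fixed points are limits of linear combinations of balanced monomials. -/
lemma mem_closure_of_forall_map_eq {L : Fin d → ℕ} {σ : ℝ → A →⋆ₐ[ℂ] A}
    (hσ : ∀ t i, σ t (s i) = Complex.exp (Complex.I * t * L i) • s i)
    (hdense : Dense (Submodule.span ℂ (monomials s) : Set A)) {x : A} (hx : ∀ t, σ t x = x) :
    x ∈ closure (Submodule.span ℂ (balancedMonomials L s) : Set A) := by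
  rw [Metric.mem_closure_iff]
  intro ε hε
  obtain ⟨y, hy, hys⟩ := Metric.dense_iff.1 hdense x ε hε
  obtain ⟨N₀, hN₀⟩ := exists_rootMean_mem_span hσ hys
  set N := N₀ + 1 with hN
  have hN0 : (N : ℂ) ≠ 0 := Nat.cast_ne_zero.2 N₀.succ_ne_zero
  refine ⟨_, hN₀ N N₀.le_succ, ?_⟩
  -- As x is its own mean and averaging is contractive, the mean of y is no farther from x than y
  -- is.
  have h1 : x - rootMean σ N y = rootMean σ N (x - y) := by
    simp only [rootMean, map_sub, Finset.sum_sub_distrib, smul_sub, hx]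
    rw [Finset.sum_const, Finset.card_range, ← Nat.cast_smul_eq_nsmul ℂ, smul_smul,
      inv_mul_cancel₀ hN0, one_smul]
  rw [Metric.mem_ball, dist_comm, dist_eq_norm] at hy
  rw [dist_eq_norm, h1, rootMean, norm_smul, norm_inv, Complex.norm_natCast]
  refine lt_of_le_of_lt ?_ hy
  rw [inv_mul_le_iff₀ (by positivity)]
  refine (norm_sum_le _ _).trans ?_
  calc ∑ j ∈ Finset.range N, ‖σ (2 * Real.pi * j / N) (x - y)‖
      ≤ ∑ _j ∈ Finset.range N, ‖x - y‖ :=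
        Finset.sum_le_sum fun j _ => NonUnitalStarAlgHom.norm_apply_le _ _
    _ = N * ‖x - y‖ := by simp

end IsCuntz

/-! ### The Cuntz algebra -/

namespace CuntzAlgebra

variable {d : ℕ} {L : Fin d → ℕ}

lemma isCuntz_s : IsCuntz (s : Fin d → CuntzAlgebra d) := ⟨star_s_mul_s, sum_s_mul_star_s⟩

lemma nontrivial_of_pos (hd : 0 < d) : Nontrivial (CuntzAlgebra d) := by
  refine ⟨1, 0, fun h => one_ne_zero (α := (CuntzRealization.family hd).carrier) ?_⟩
  rw [← map_one (lift (CuntzRealization.family hd)), h, map_zero]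

lemma exists_mem_adjoin_of_mem_adjoin {y : CuntzProduct d}
    (hy : y ∈ StarAlgebra.adjoin ℂ (Set.range (CuntzProduct.gen (d := d)))) :
    ∃ z ∈ StarAlgebra.adjoin ℂ (Set.range (s : Fin d → CuntzAlgebra d)), z.1 = y := by
  induction hy using StarAlgebra.adjoin_induction with
  | mem y h =>
    obtain ⟨i, rfl⟩ := h
    exact ⟨s i, StarAlgebra.subset_adjoin ℂ _ ⟨i, rfl⟩, rfl⟩
  | algebraMap r => exact ⟨algebraMap ℂ _ r, StarSubalgebra.algebraMap_mem _ r, rfl⟩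
  | add x y _ _ hx hy =>
    obtain ⟨a, ha, rfl⟩ := hx
    obtain ⟨b, hb, rfl⟩ := hy
    exact ⟨a + b, add_mem ha hb, rfl⟩
  | mul x y _ _ hx hy =>
    obtain ⟨a, ha, rfl⟩ := hx
    obtain ⟨b, hb, rfl⟩ := hy
    exact ⟨a * b, mul_mem ha hb, rfl⟩
  | star x _ hx =>
    obtain ⟨a, ha, rfl⟩ := hx
    exact ⟨star a, star_mem ha, rfl⟩

lemma dense_span_monomials :
    Dense (Submodule.span ℂ (IsCuntz.monomials (s : Fin d → CuntzAlgebra d)) :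
      Set (CuntzAlgebra d)) := by
  intro x
  rw [Metric.mem_closure_iff]
  intro ε hε
  have hx : x.1 ∈ closure
      (StarAlgebra.adjoin ℂ (Set.range (CuntzProduct.gen (d := d))) : Set (CuntzProduct d)) := x.2
  obtain ⟨y, hy, hxy⟩ := Metric.mem_closure_iff.1 hx ε hε
  obtain ⟨z, hz, rfl⟩ := exists_mem_adjoin_of_mem_adjoin hy
  exact ⟨z, isCuntz_s.mem_span_of_mem_adjoin hz, hxy⟩

lemma sigma_monomial_mul_star (t : ℝ) (α γ : List (Fin d)) :
    sigma L t (monomial s α * star (monomial s γ)) =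
      Complex.exp (Complex.I * t * ((wordWeight L α : ℂ) - wordWeight L γ)) •
        (monomial s α * star (monomial s γ)) :=
  IsCuntz.map_monomial_mul_star (σ := fun t => (sigma L t : CuntzAlgebra d →⋆ₐ[ℂ] CuntzAlgebra d))
    (sigma_s L) t α γ

lemma monomial_mul_star_mem_fixedPoints {α γ : List (Fin d)}
    (h : wordWeight L α = wordWeight L γ) :
    monomial s α * star (monomial s γ) ∈ fixedPoints L := by
  intro t
  rw [sigma_monomial_mul_star, h, sub_self, mul_zero, Complex.exp_zero, one_smul]

/-- The element `s_α s_γ*` of the fixed-point algebra, for `α`, `γ` of equal weight. -/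
noncomputable def balanced (L : Fin d → ℕ) (α γ : List (Fin d)) : fixedPoints L :=
  if h : wordWeight L α = wordWeight L γ then
    ⟨monomial s α * star (monomial s γ), monomial_mul_star_mem_fixedPoints h⟩
  else 0

lemma coe_balanced {α γ : List (Fin d)} (h : wordWeight L α = wordWeight L γ) :
    (balanced L α γ : CuntzAlgebra d) = monomial s α * star (monomial s γ) := by
  rw [balanced, dif_pos h]

lemma balanced_of_ne {α γ : List (Fin d)} (h : wordWeight L α ≠ wordWeight L γ) :
    balanced L α γ = 0 := dif_neg h

lemma dense_span_balanced :
    Dense (Submodule.span ℂ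
      {x | ∃ α γ, wordWeight L α = wordWeight L γ ∧ balanced L α γ = x} :
      Set (fixedPoints L)) := by
  intro x
  rw [Metric.mem_closure_iff]
  intro ε hε
  have hx := IsCuntz.mem_closure_of_forall_map_eq
    (σ := fun t => (sigma L t : CuntzAlgebra d →⋆ₐ[ℂ] CuntzAlgebra d))
    (sigma_s L) dense_span_monomials (x := x.1) x.2
  obtain ⟨y, hy, hxy⟩ := Metric.mem_closure_iff.1 hx ε hε
  have hle : Submodule.span ℂ (IsCuntz.balancedMonomials L s) ≤
      (Submodule.span ℂ {x | ∃ α γ, wordWeight L α = wordWeight L γ ∧ balanced L α γ = x}).map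
        (fixedPoints L).subtype.toLinearMap := by
    rw [Submodule.span_le]
    rintro _ ⟨α, γ, hw, rfl⟩
    exact ⟨balanced L α γ, Submodule.subset_span ⟨α, γ, hw, rfl⟩, coe_balanced hw⟩
  obtain ⟨z, hz, rfl⟩ := hle hy
  exact ⟨z, hz, hxy⟩

/-- The default value 0 of `balanced` at unequal weights lets `star_eq` and `mul_eq_zero` hold for
all words. Nonvanishing reduces to 1 ≠ 0 in 𝒪_d, which the realization on ℓ²(ℕ) provides. -/
lemma isWordUnits_balanced (hd : 0 < d) : IsWordUnits L (balanced L) where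
  star_eq α γ := by
    by_cases h : wordWeight L α = wordWeight L γ
    · apply Subtype.ext
      rw [StarMemClass.coe_star, coe_balanced h, coe_balanced h.symm, star_mul, star_star]
    · rw [balanced_of_ne h, balanced_of_ne (Ne.symm h), star_zero]
  mul_eq α γ δ h₁ h₂ := by
    apply Subtype.ext
    rw [MulMemClass.coe_mul, coe_balanced h₁, coe_balanced h₂, coe_balanced (h₁.trans h₂),
      mul_assoc, ← mul_assoc (star _), isCuntz_s.star_monomial_mul_self, one_mul]
  mul_eq_zero α γ δ ε h₁ h₂ := by
    by_cases h : wordWeight L α = wordWeight L γ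
    · by_cases h' : wordWeight L δ = wordWeight L ε
      · apply Subtype.ext
        rw [MulMemClass.coe_mul, coe_balanced h, coe_balanced h', mul_assoc, ← mul_assoc (star _),
          isCuntz_s.star_monomial_mul_eq_zero h₁ h₂, zero_mul, mul_zero, ZeroMemClass.coe_zero]
      · rw [balanced_of_ne h', mul_zero]
    · rw [balanced_of_ne h, zero_mul]
  nil_eq_one := by
    apply Subtype.ext
    rw [coe_balanced rfl, IsCuntz.monomial_nil, star_one, mul_one, OneMemClass.coe_one]
  sum_eq α γ h := by
    apply Subtype.ext
    rw [AddSubmonoidClass.coe_finsetSum, coe_balanced h]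
    have h1 (k : Fin d) : (balanced L (α ++ [k]) (γ ++ [k]) : CuntzAlgebra d) =
        monomial s α * (s k * star (s k)) * star (monomial s γ) := by
      rw [coe_balanced (by simp [h]), IsCuntz.monomial_append, IsCuntz.monomial_append, star_mul]
      simp only [monomial, List.map_cons, List.map_nil, List.prod_cons, List.prod_nil, mul_one,
        mul_assoc]
    simp only [h1]
    rw [← Finset.sum_mul, ← Finset.mul_sum, sum_s_mul_star_s, mul_one]
  dense := dense_span_balanced
  ne_zero α h := by
    have := nontrivial_of_pos hd
    have h1 := congrArg (fun x : fixedPoints L =>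
      star (monomial s α) * (x : CuntzAlgebra d) * monomial s α) h
    simp only [coe_balanced rfl, ZeroMemClass.coe_zero, mul_zero, zero_mul] at h1
    rw [← mul_assoc, isCuntz_s.star_monomial_mul_self, one_mul,
      isCuntz_s.star_monomial_mul_self] at h1
    exact one_ne_zero h1

lemma prod_map_exp (β : ℝ) (α : List (Fin d)) :
    (α.map fun i => Real.exp (-β * L i)).prod = Real.exp (-β * wordWeight L α) := by
  induction α with
  | nil => simp
  | cons k α ih =>
    rw [List.map_cons, List.prod_cons, ih, ← Real.exp_add, wordWeight_cons]
    push_cast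
    ring_nf

/-- The quasi-free state and the trace states of the fixed-point algebra. -/
lemma exists_state_and_trace (hd : 2 ≤ d) (hpos : ∀ i, 0 < L i) (hgcd : Finset.univ.gcd L = 1)
    {β : ℝ} (hβ0 : 0 < β) (hβ : ∑ i, Real.exp (-β * L i) = 1) :
    ∃ ω : CuntzAlgebra d →ₗ[ℂ] ℂ, IsState ω ∧
      (∀ α γ : List (Fin d), ω (word α * star (word γ)) =
        if α = γ then (((α.map fun i => Real.exp (-β * L i)).prod : ℝ) : ℂ) else 0) ∧
      (∀ ω' : CuntzAlgebra d →ₗ[ℂ] ℂ, IsState ω' →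
        (∀ α γ : List (Fin d), ω' (word α * star (word γ)) =
          if α = γ then (((α.map fun i => Real.exp (-β * L i)).prod : ℝ) : ℂ) else 0) →
        ω' = ω) ∧
      ∀ τ : fixedPoints L →ₗ[ℂ] ℂ, IsTraceState τ ↔ ∀ x, τ x = ω x := by
  have hd0 : 0 < d := by omega
  have := nontrivial_of_pos hd0
  -- The uniform bound q = e^{-β} < 1 that drives the geometric decay; it uses L_k ≥ 1 and β > 0.
  have hp (k : Fin d) : Real.exp (-β * L k) ≤ Real.exp (-β) := by
    have : (1 : ℝ) ≤ L k := by exact_mod_cast hpos k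
    exact Real.exp_le_exp.2 (by nlinarith)
  obtain ⟨ω, hω, hωw⟩ := isCuntz_s.exists_state (fun k => (Real.exp_pos _).le) hβ hp
    (Real.exp_lt_one_iff.2 (by linarith)) (dense_span_monomials (d := d))
  refine ⟨ω, hω, hωw, fun ω' hω' hω'w => ?_, fun τ => ?_⟩
  · refine LinearMap.ext_of_dense_span hω'.continuous hω.continuous dense_span_monomials ?_
    rintro _ ⟨α, γ, rfl⟩
    exact (hω'w α γ).trans (hωw α γ).symm
  · have hE := isWordUnits_balanced (L := L) hd0
    set φ : fixedPoints L →ₗ[ℂ] ℂ := ω ∘ₗ (fixedPoints L).subtype.toLinearMap with hφ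
    have hφc : Continuous φ := hω.continuous.comp continuous_subtype_val
    have hφE (α γ : List (Fin d)) (h : wordWeight L α = wordWeight L γ) : φ (balanced L α γ) =
        if α = γ then ((Real.exp (-β * wordWeight L α) : ℝ) : ℂ) else 0 := by
      rw [← prod_map_exp]
      exact (congrArg ω (coe_balanced h)).trans (hωw α γ)
    constructor
    · intro hτ x
      rw [hE.trace_eq hpos hgcd hβ hτ hφc hφE]
      rfl
    · intro h
      obtain rfl : τ = φ := LinearMap.ext h
      exact ⟨⟨fun a => hω.1 a.1, hω.2⟩, hE.map_mul_comm_of_map_E hd0 hpos hφc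
        (t := fun n => ((Real.exp (-β * n) : ℝ) : ℂ)) hφE⟩

end CuntzAlgebra

theorem mainTheorem5 (d : ℕ) (hd : 2 ≤ d) (L : Fin d → ℕ) (hL : Monotone L)
    (hpos : ∀ i, 0 < L i) (hgcd : Finset.univ.gcd L = 1) :
    -- `𝔄_L` is a simple AF-algebra
    IsAFAlgebra (CuntzAlgebra.fixedPoints L) ∧
    IsSimpleCStarAlgebra (CuntzAlgebra.fixedPoints L) ∧
    -- the Bratteli diagram, its stabilization, and primitivity of `J_L`
    HasBratteliDiagram (CuntzAlgebra.fixedPoints L) (fixedPointDiagram L) ∧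
    {nm : ℕ × Fin (maxWeight L) | nodeDim L nm.1 nm.2 = 0}.Finite ∧
    (fixedPointDiagram L).StabilizesTo (incidenceMatrix L) ∧
    ((incidenceMatrix L).map (Nat.cast : ℕ → ℝ)).IsPrimitive ∧
    ∃ β : ℝ, 0 < β ∧ ∑ i, Real.exp (-β * L i) = 1 ∧
      (∀ β' : ℝ, ∑ i, Real.exp (-β' * L i) = 1 → β' = β) ∧
      -- the state `ω` on `𝒪_d`; its restriction is the only trace state of `𝔄_L`
      (∃ ω : CuntzAlgebra d →ₗ[ℂ] ℂ, IsState ω ∧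
        (∀ α γ : List (Fin d), ω (CuntzAlgebra.word α * star (CuntzAlgebra.word γ)) =
          if α = γ then (((α.map fun i => Real.exp (-β * L i)).prod : ℝ) : ℂ) else 0) ∧
        (∀ ω' : CuntzAlgebra d →ₗ[ℂ] ℂ, IsState ω' →
          (∀ α γ : List (Fin d), ω' (CuntzAlgebra.word α * star (CuntzAlgebra.word γ)) =
            if α = γ then (((α.map fun i => Real.exp (-β * L i)).prod : ℝ) : ℂ) else 0) →
          ω' = ω) ∧
        ∀ τ : CuntzAlgebra.fixedPoints L →ₗ[ℂ] ℂ,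
          IsTraceState τ ↔ ∀ x, τ x = ω x) ∧
      -- the Perron–Frobenius eigenvalue of `J_L` is `e^β`, its only positive eigenvalue
      IsPerronFrobeniusEigenvalue ((incidenceMatrix L).map (Nat.cast : ℕ → ℝ)) (Real.exp β) ∧
      ∀ r : ℝ, 0 < r →
        Module.End.HasEigenvalue
          (Matrix.toLin' ((incidenceMatrix L).map (Nat.cast : ℕ → ℝ))) r →
        r = Real.exp β := by
  have hd0 : 0 < d := by omega
  have hE := CuntzAlgebra.isWordUnits_balanced (L := L) hd0
  have hB := hE.hasBratteliDiagram hd0 hpos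
  obtain ⟨β, hβ0, hβ, huniq⟩ := exists_unique_sum_exp_eq_one hd hpos
  exact ⟨hB.isAFAlgebra, hE.isSimple hd0 hpos hgcd, hB,
    finite_setOf_nodeDim_eq_zero hd0 hpos hgcd, fixedPointDiagram_stabilizesTo hd0 hpos hgcd,
    incidenceMatrix_isPrimitive hd0 hpos hgcd, β, hβ0, hβ, huniq,
    CuntzAlgebra.exists_state_and_trace hd hpos hgcd hβ0 hβ,
    isPerronFrobeniusEigenvalue_incidenceMatrix hd0 hpos hgcd hβ,
    eq_exp_of_hasEigenvalue hd0 hpos huniq⟩
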